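/- Let $S^2\subset\mathbb R^3$ be the unit sphere with its round metric $\bar g$ of curvature $1$ and its area form $\bar\mu$ (for the orientation as boundary of the ball), let $(\theta,\varphi)$ be the positively oriented polar coordinates about the north pole, so that $\bar g=d\theta^2+\sin^2\theta\,d\varphi^2$ and $\bar\mu=\sin\theta\,d\theta\wedge d\varphi$, and put $h=\cos\theta$ and $\beta=\bar g(\partial_\varphi,\cdot)=\sin^2\theta\,d\varphi$. For a two-form $\sigma$ on $S^2$ let $\omega_\sigma=d\lambda-\pi^*\sigma$ on $\pi:T^*S^2\to S^2$, where $\lambda$ is the canonical $1$-form; the Hamiltonian vector field $X$ of a function $H$ with respect to $\omega_\sigma$ is defined by $\iota_X\omega_\sigma=-dH$. For a Riemannian metric $g$ put $H_g(q,p)=\tfrac12|p|_g^2$; the magnetic flow of $(g,\sigma)$ is the Hamiltonian flow of $H_g$ with respect to $\omega_\sigma$. With $|\cdot|$ the norm of $\bar g$, set for $s\ge 0$, $\alpha\in[0,1)$ and $k>0$ $$H_{s,\alpha}(q,p)=\sqrt{|p|^2+s^2}+\alpha\big(p(\partial_\varphi)+s\,h(q)\big),\qquad c=c_{s,\alpha,k}=\sqrt{2k+s^2}+\alpha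 s,\qquad r=r_{s,\alpha,k}=\frac{c-\alpha s h}{1-\alpha^2|\partial_\varphi|^2}.$$ **Proposition.** For all $s\ge0$, $0\le\alpha<1$ and $k>0$ there is a smooth Riemannian metric $g=g_{s,\alpha,k}$ on $S^2$ whose induced inner products on the cotangent spaces are $$g(p_1,p_2)=\frac{2k}{(1-\alpha^2|\partial_\varphi|^2)r^2-s^2}\Big(\bar g(p_1,p_2)-\alpha^2p_1(\partial_\varphi)\,p_2(\partial_\varphi)\Big),$$ and the magnetic flow of the pair $\big(g,\ s\bar\mu+d(\alpha r\beta)\big)$ on the level $\{H_g=k\}$ is conjugate, up to time reparametrisation, to the Hamiltonian flow of $H_{s,\alpha}$ with respect to $\omega_{s\bar\mu}$ on the level $\{H_{s,\alpha}=c\}$. Precisely: both Hamiltonians are smooth near, and both flows $\Phi_t$ and $\Psi_t$ are defined for all times on, these levels; the fibre translation $F(q,p)=(q,\,p-\alpha r(q)\beta_q)$ is a diffeomorphism of $T^*S^2$ which maps the first level onto the second; and there are a positive function $f$, smooth near $\{H_g=k\}$, and, for every $z\in\{H_g=k\}$, a bijection $\tau_z:\mathbb R\to\mathbb R$ with $\tau_z(0)=0$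 and $\tau_z'(t)=f(\Phi_t(z))$ such that $F(\Phi_t(z))=\Psi_{\tau_z(t)}(F(z))$ for all $t\in\mathbb R$. -/

import Mathlib

open scoped Manifold ContDiff

noncomputable section

namespace MagneticKatok

/-! ### Differential forms and Hamiltonian flows on manifolds -/

section General

variable {E : Type*} [NormedAddCommGroup E] [NormedSpace ℝ E]
  {H : Type*} [TopologicalSpace H] (I : ModelWithCorners ℝ E H)
  (M : Type*) [TopologicalSpace M] [ChartedSpace H M]

/-- Differential `n`-forms (no smoothness imposed): an alternating `n`-linear form on each
tangent space. -/
abbrev Form (n : ℕ) : Type _ := ∀ x : M, TangentSpace I x [⋀^Fin n]→L[ℝ] ℝ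

variable {M}

/-- A covector field, viewed as a differential `1`-form. -/
def oneForm (η : ∀ x : M, TangentSpace I x →L[ℝ] ℝ) : Form I M 1 :=
  fun x => ContinuousAlternatingMap.ofSubsingleton ℝ (TangentSpace I x) ℝ (0 : Fin 1) (η x)

/-- The exterior derivative of a differential form on a manifold without boundary, computed at `x`
in the preferred chart at `x`: the form is pulled back by the inverse chart, differentiated in the
model vector space, and the result is pulled back by the chart. (For a smooth form the result does
not depend on the chart.) -/
def extD [I.Boundaryless] {n : ℕ} (w : Form I M n) : Form I M (n + 1) := fun x =>
  (extDeriv (fun y : E =>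
      (w ((extChartAt I x).symm y)).compContinuousLinearMap
        (mfderiv 𝓘(ℝ, E) I (extChartAt I x).symm y ∘L
          (NormedSpace.fromTangentSpace (𝕜 := ℝ) y).symm.toContinuousLinearMap))
    (extChartAt I x x)).compContinuousLinearMap (mvfderiv I (extChartAt I x) x)

variable {E' : Type*} [NormedAddCommGroup E'] [NormedSpace ℝ E']
  {H' : Type*} [TopologicalSpace H'] (I' : ModelWithCorners ℝ E' H')
  {M' : Type*} [TopologicalSpace M'] [ChartedSpace H' M']

/-- The pullback `f^* w` of a differential form. -/
def pullbackForm (f : M → M') {n : ℕ} (w : Form I' M' n) : Form I M n :=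
  fun x => (w (f x)).compContinuousLinearMap (mfderiv I I' f x)

/-- `v` is the value at `z` of the Hamiltonian vector field `X` of `h` with respect to the two-form
`w`, with the sign convention `ι_X w = - dh`. -/
def IsHamiltonianVector (w : Form I M 2) (h : M → ℝ) (z : M) (v : TangentSpace I z) : Prop :=
  ∀ ξ : TangentSpace I z, w z ![v, ξ] = - mvfderiv I h z ξ

/-- `Φ` is, on the set `N`, the (complete) Hamiltonian flow of `h` with respect to the two-form `w`:
near `N` the function `h` is smooth, at the points of `N` the equation `ι_X w = - dh` determines a
unique vector `X`, and, for every `z ∈ N`, the curve `t ↦ Φ t z` is defined for all times, starts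
at `z`, stays in `N`, and is an integral curve of `X`. -/
structure IsHamiltonianFlowOn (w : Form I M 2) (h : M → ℝ) (N : Set M) (Φ : ℝ → M → M) : Prop where
  smooth : ∀ z ∈ N, ContMDiffAt I 𝓘(ℝ, ℝ) ∞ h z
  existsUnique_vector : ∀ z ∈ N, ∃! v : TangentSpace I z, IsHamiltonianVector I w h z v
  map_zero : ∀ z ∈ N, Φ 0 z = z
  mapsTo : ∀ z ∈ N, ∀ t : ℝ, Φ t z ∈ N
  integralCurve : ∀ z ∈ N, ∀ t : ℝ, ∃ v : TangentSpace I (Φ t z),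
    IsHamiltonianVector I w h (Φ t z) v ∧
    HasMFDerivAt 𝓘(ℝ, ℝ) I (fun τ : ℝ => Φ τ z) t ((1 : ℝ →L[ℝ] ℝ).smulRight v)

/-- The diffeomorphism `F` restricts to a bijection from `N` onto `N'` which conjugates the flow `φ`
on `N` to the flow `ψ` on `N'` up to time reparametrisation: `F (φ_t z) = ψ_{τ(t, z)} (F z)`, where,
for every `z ∈ N`, the time change `τ(·, z)` is a bijection of `ℝ` with `τ(0, z) = 0`, whose time
derivative is `f (φ_t z)` for a positive function `f` which is smooth near `N`. -/
def ConjugatesUpToTimeChange (F : M ≃ₘ^∞⟮I, I⟯ M) (φ ψ : ℝ → M → M) (N N' : Set M) : Prop :=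
  F '' N = N' ∧
  ∃ (f : M → ℝ) (τ : ℝ → M → ℝ),
    (∀ z ∈ N, ContMDiffAt I 𝓘(ℝ, ℝ) ∞ f z ∧ 0 < f z) ∧
    ∀ z ∈ N, τ 0 z = 0 ∧ Function.Bijective (fun t : ℝ => τ t z) ∧
      (∀ t : ℝ, HasDerivAt (fun t : ℝ => τ t z) (f (φ t z)) t) ∧
      ∀ t : ℝ, F (φ t z) = ψ (τ t z) (F z)

end General

/-- The inner product induced on the dual of `V` by an inner product `G` on the finite-dimensional
space `V`: `⟨p₁, p₂⟩ = p₁ (p₂♯)`, where `p₂♯ ∈ V` is the vector with `G p₂♯ = p₂`. -/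
def dualInner {V : Type*} [AddCommGroup V] [Module ℝ V] [TopologicalSpace V]
    [IsTopologicalAddGroup V] [ContinuousSMul ℝ V]
    (G : V →L[ℝ] V →L[ℝ] ℝ) (p₁ p₂ : V →L[ℝ] ℝ) : ℝ :=
  p₁ (G.inverse p₂)

/-! ### The round two-sphere and its cotangent bundle -/

/-- Euclidean three-space. -/
abbrev E3 : Type := EuclideanSpace ℝ (Fin 3)

/-- The unit sphere in Euclidean three-space. -/
abbrev S2 : Type := Metric.sphere (0 : E3) 1

/-- The tangent space of the sphere at `q`. -/
abbrev TS (q : S2) : Type := TangentSpace (𝓡 2) q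

/-- The cotangent space of the sphere at `q`. -/
abbrev CoT (q : S2) : Type := TS q →L[ℝ] ℝ

/-- The model fibre of the cotangent bundle. -/
abbrev CotFibre : Type := EuclideanSpace ℝ (Fin 2) →L[ℝ] ℝ

/-- The cotangent bundle of the sphere, a point being written `(q, p) = (z.proj, z.snd)`. -/
abbrev CotS2 : Type := Bundle.TotalSpace CotFibre CoT

/-- The model with corners of the cotangent bundle. -/
abbrev ICot := (𝓡 2).prod 𝓘(ℝ, CotFibre)

/-- The differential of the inclusion of the sphere in Euclidean space. -/
def incl (q : S2) : TS q →L[ℝ] E3 := mvfderiv (𝓡 2) (fun x : S2 => (x : E3)) q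

/-- The round metric of constant curvature `1`. -/
def gbar (q : S2) : TS q →L[ℝ] TS q →L[ℝ] ℝ :=
  (incl q).precomp ℝ ∘L innerSL ℝ ∘L incl q

/-- The determinant, as an alternating form on Euclidean space. -/
def detForm : E3 [⋀^Fin 3]→L[ℝ] ℝ :=
  { (EuclideanSpace.basisFun (Fin 3) ℝ).toBasis.det with
    cont := by
      change Continuous fun v : Fin 3 → E3 => (EuclideanSpace.basisFun (Fin 3) ℝ).toBasis.det v
      simp only [Module.Basis.det_apply]
      refine Continuous.matrix_det (continuous_pi fun i => continuous_pi fun j => ?_)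
      simp only [Module.Basis.toMatrix_apply, OrthonormalBasis.coe_toBasis_repr_apply,
        EuclideanSpace.basisFun_repr]
      fun_prop }

/-- The area form `μ̄_q (u, v) = det (q, u, v)` of the round metric, for the orientation of the
sphere as the boundary of the ball. -/
def mubar : Form (𝓡 2) S2 2 :=
  fun q => (detForm.curryLeft (q : E3)).compContinuousLinearMap (incl q)

theorem exists_dphi (q : S2) : ∃ v : TS q, incl q v = !₂[-(q : E3) 1, (q : E3) 0, 0] := by
  have h : (!₂[-(q : E3) 1, (q : E3) 0, 0] : E3) ∈ (incl q).range := by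
    have : Fact (Module.finrank ℝ E3 = 2 + 1) := ⟨by simp⟩
    rw [incl, range_mvfderiv_subtypeVal (n := 2), Submodule.mem_orthogonal_singleton_iff_inner_right,
      PiLp.inner_apply, Fin.sum_univ_three]
    simp
    ring
  exact h

/-- The vector field `∂_φ` generating the rotations around the third axis: as a vector of Euclidean
space it is `(-y, x, 0)` at the point `q = (x, y, z)` of the sphere, which determines it since the
differential of the inclusion is injective. -/
def dphi (q : S2) : TS q := Classical.choose (exists_dphi q)

/-- The function `h = cos θ`, where `θ` is the polar angle (the distance from the north pole). -/
def height (q : S2) : ℝ := (q : E3) 2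

/-- The `1`-form `β` dual to `∂_φ` with respect to the round metric. -/
def beta (q : S2) : CoT q := gbar q (dphi q)

/-- The canonical `1`-form `λ_{(q,p)} = p ∘ dπ` on the cotangent bundle. -/
def liouville : Form ICot CotS2 1 :=
  oneForm ICot fun z : CotS2 =>
    z.snd ∘L mfderiv ICot (𝓡 2) (Bundle.TotalSpace.proj : CotS2 → S2) z

/-- The twisted symplectic form `ω_σ = dλ - π^* σ` on the cotangent bundle. -/
def twisted (σ : Form (𝓡 2) S2 2) : Form ICot CotS2 2 :=
  extD ICot liouville - pullbackForm ICot (𝓡 2) (Bundle.TotalSpace.proj : CotS2 → S2) σ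

/-- The kinetic energy `H_g (q, p) = |p|_g ^ 2 / 2` of a Riemannian metric `g`. -/
def kinetic (g : Bundle.ContMDiffRiemannianMetric (𝓡 2) ∞ (EuclideanSpace ℝ (Fin 2)) TS)
    (z : CotS2) : ℝ :=
  dualInner (g.inner z.proj) z.snd z.snd / 2

/-- `R_s (q, p) = √(|p|² + s²)`, where `|p|` is the norm induced by the round metric. -/
def Rfun (s : ℝ) (z : CotS2) : ℝ := √(dualInner (gbar z.proj) z.snd z.snd + s ^ 2)

/-- `Ω_s (q, p) = p (∂_φ) + s h (q)`. -/
def Omegafun (s : ℝ) (z : CotS2) : ℝ := z.snd (dphi z.proj) + s * height z.proj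

/-- The Hamiltonian `H_{s,α} = R_s + α Ω_s`. -/
def Hfun (s α : ℝ) (z : CotS2) : ℝ := Rfun s z + α * Omegafun s z

/-- The energy value `c_{s,α,k} = √(2 k + s²) + α s`. -/
def cval (s α k : ℝ) : ℝ := √(2 * k + s ^ 2) + α * s

/-- The squared norm `|∂_φ|²` with respect to the round metric. -/
def dphiSq (q : S2) : ℝ := gbar q (dphi q) (dphi q)

/-- The function `r_{s,α,k} = (c - α s h) / (1 - α² |∂_φ|²)`. -/
def rfun (s α k : ℝ) (q : S2) : ℝ :=
  (cval s α k - α * s * height q) / (1 - α ^ 2 * dphiSq q)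

/-- The `1`-form `η = α r_{s,α,k} β`. -/
def etaForm (s α k : ℝ) (q : S2) : CoT q := (α * rfun s α k q) • beta q

/-- The formula for the inner products induced on the cotangent spaces by the metric
`g_{s,α,k}`. -/
def gDualFormula (s α k : ℝ) (q : S2) (p₁ p₂ : CoT q) : ℝ :=
  2 * k / ((1 - α ^ 2 * dphiSq q) * rfun s α k q ^ 2 - s ^ 2) *
    (dualInner (gbar q) p₁ p₂ - α ^ 2 * p₁ (dphi q) * p₂ (dphi q))

/-- The magnetic form `s μ̄ + d (α r_{s,α,k} β)`. -/
def magneticForm (s α k : ℝ) : Form (𝓡 2) S2 2 :=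
  s • mubar + extD (𝓡 2) (oneForm (𝓡 2) (etaForm s α k))

end MagneticKatok

end

noncomputable section

open scoped Manifold ContDiff Topology RealInnerProductSpace

namespace MagneticKatok

/-! Everything is read in Euclidean space: `pos` and `mom` send $(q,p)$ to $q$ and to the vector
$P$, tangent to the sphere at $q$, which is dual to $p$. Then $d\lambda=\sum_i dP_i\wedge dq_i$
(`liouville_eq`, `extD_oneForm_inner`), so the twisted forms are explicit (`twisted_apply`) and
nondegenerate (`twisted_nondegenerate`).

The flow of $H_{s,\alpha}$ is then explicit and complete. Put $J=q\times P+sq$, so that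
$|J|=R_s=:R$. The summand $R_s$ rotates $(q,P)$ about $J/R$ at unit speed, the summand
$\alpha\Omega_s$ rotates about the third axis at speed $\alpha$, and composing the two rotations
gives the orbit (`exists_orbit`).

For the comparison put $\eta=\alpha r\beta$. Since $F^*\lambda=\lambda-\pi^*\eta$, one has
$F^*\omega_{s\bar\mu}=\omega_{s\bar\mu+d\eta}$ (`twisted_translate`). With $\ell=r-\alpha
p(\partial_\varphi)$ (`slack`) and $w=(1-\alpha^2|\partial_\varphi|^2)r^2-s^2$, the choice of $r$
gives $H_{s,\alpha}\circ F-c=R\circ F-\ell$ and $(R\circ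
F)^2-\ell^2=|p|^2-\alpha^2p(\partial_\varphi)^2-w$, whence $H_g-k=\frac kw(R\circ
F+\ell)(H_{s,\alpha}\circ F-c)$ (`kinetic_sub`).

On $\{H_g=k\}$ Cauchy-Schwarz forces $|p(\partial_\varphi)|\le r$, so $\ell>0$. Hence $F$ matches
the levels (`kinetic_eq_iff`), and there $dH_g=f\,F^*dH_{s,\alpha}$ with $f=2k\ell/w$
(`mvfderiv_kinetic`), so $F$ carries one Hamiltonian field to $f$ times the other. As $f$ is
positive and bounded on the level, $\tau'=f$ is solved by a bijection of the line
(`exists_timeChange`), and the magnetic flow is obtained by pulling back the reparametrised explicit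
flow (`exists_flow_conjugatesUpToTimeChange`). -/

/-! ### Covectors on the sphere as tangent vectors in Euclidean space -/

theorem isInvertible_of_pos {V : Type*} [AddCommGroup V] [Module ℝ V] [TopologicalSpace V]
    [IsTopologicalAddGroup V] [ContinuousSMul ℝ V] [T2Space V] [FiniteDimensional ℝ V]
    (G : V →L[ℝ] V →L[ℝ] ℝ) (h : ∀ v, v ≠ 0 → 0 < G v v) : G.IsInvertible := by
  have hinj : Function.Injective G := by
    rw [injective_iff_map_eq_zero]
    intro v hv
    by_contra hne
    have := h v hne
    simp [hv] at this
  have e : (V →ₗ[ℝ] ℝ) ≃ₗ[ℝ] (V →L[ℝ] ℝ) := LinearMap.toContinuousLinearMap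
  have : FiniteDimensional ℝ (V →L[ℝ] ℝ) := e.finiteDimensional
  have hd : Module.finrank ℝ V = Module.finrank ℝ (V →L[ℝ] ℝ) := by
    rw [← e.finrank_eq]
    exact (Subspace.dual_finrank_eq (K := ℝ) (V := V)).symm
  exact ⟨(LinearEquiv.ofInjectiveOfFinrankEq (G : V →ₗ[ℝ] V →L[ℝ] ℝ) hinj hd).toContinuousLinearEquiv, by ext; rfl⟩

instance (q : S2) : T2Space (TS q) := inferInstanceAs (T2Space (EuclideanSpace ℝ (Fin 2)))
instance (q : S2) : FiniteDimensional ℝ (TS q) := inferInstanceAs (FiniteDimensional ℝ (EuclideanSpace ℝ (Fin 2)))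

instance : Fact (Module.finrank ℝ E3 = 2 + 1) := ⟨by simp⟩

theorem incl_injective (q : S2) : Function.Injective (incl q) :=
  injective_mvfderiv_subtypeVal_sphere (n := 2) q

theorem mem_range_incl (q : S2) (x : E3) : (∃ v, incl q v = x) ↔ inner ℝ (q : E3) x = 0 := by
  have := range_mvfderiv_subtypeVal (n := 2) q
  rw [← Submodule.mem_orthogonal_singleton_iff_inner_right, ← this]
  rfl

/-- The smoothness statements below for covectors and for metrics are reduced to this coordinate
expression of the differential of the inclusion. -/
theorem inclCoord_contMDiffAt (x₀ : S2) :
    ContMDiffAt (𝓡 2) 𝓘(ℝ, EuclideanSpace ℝ (Fin 2) →L[ℝ] E3) ∞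
      (fun q : S2 => incl q ∘L (trivializationAt (EuclideanSpace ℝ (Fin 2)) TS x₀).symmL ℝ q) x₀ := by
  have h := ContMDiffAt.mfderiv_const (I := 𝓡 2) (I' := 𝓘(ℝ, E3)) (m := ∞) (n := ∞) (x₀ := x₀)
    (f := fun q : S2 => (q : E3)) (contMDiff_coe_sphere (n := 2) x₀) (by simp)
  refine h.congr_of_eventuallyEq (Filter.Eventually.of_forall fun q => ?_)
  ext v i
  simp [inTangentCoordinates, ContinuousLinearMap.inCoordinates]
  rfl

/-- The covector at `q` obtained by restricting the linear form `⟨y, ·⟩` to the tangent plane. -/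
def flat (q : S2) (y : E3) : CoT q := innerSL ℝ y ∘L incl q

/-- The vector of Euclidean space, tangent to the sphere at `q`, which represents the covector `p`. -/
def sharp (q : S2) (p : CoT q) : E3 := incl q ((gbar q).inverse p)

theorem gbar_apply (q : S2) (v w : TS q) : gbar q v w = inner ℝ (incl q v) (incl q w) := rfl

theorem gbar_pos (q : S2) (v : TS q) (hv : v ≠ 0) : 0 < gbar q v v := by
  rw [gbar_apply, real_inner_self_pos]
  exact fun h => hv (incl_injective q (by simpa using h))

theorem isInvertible_gbar (q : S2) : (gbar q).IsInvertible := isInvertible_of_pos _ (gbar_pos q)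

theorem gbar_inverse (q : S2) (p : CoT q) : gbar q ((gbar q).inverse p) = p := by
  exact (isInvertible_gbar q).self_apply_inverse p

theorem inner_sharp (q : S2) (p : CoT q) (v : TS q) : inner ℝ (sharp q p) (incl q v) = p v := by
  rw [sharp, ← gbar_apply, gbar_inverse]

theorem inner_coe_incl (q : S2) (v : TS q) : inner ℝ (q : E3) (incl q v) = 0 :=
  (mem_range_incl q _).1 ⟨v, rfl⟩

theorem inner_coe_sharp (q : S2) (p : CoT q) : inner ℝ (q : E3) (sharp q p) = 0 :=
  inner_coe_incl q _

@[simp] theorem flat_apply (q : S2) (y : E3) (v : TS q) : flat q y v = inner ℝ y (incl q v) := rfl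

@[simp] theorem flat_sharp (q : S2) (p : CoT q) : flat q (sharp q p) = p := by
  ext v; simp [inner_sharp]

/-- The difference of two tangent vectors is tangent, so it may be tested against itself. -/
theorem eq_of_flat_eq (q : S2) {x y : E3} (hx : inner ℝ (q : E3) x = 0)
    (hy : inner ℝ (q : E3) y = 0) (h : flat q x = flat q y) : x = y := by
  obtain ⟨v, hv⟩ := (mem_range_incl q (x - y)).2 (by rw [inner_sub_right, hx, hy, sub_zero])
  have := DFunLike.congr_fun h v
  rw [flat_apply, flat_apply, hv, ← sub_eq_zero, ← inner_sub_left, inner_self_eq_zero,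
    sub_eq_zero] at this
  exact this

theorem sharp_flat (q : S2) {y : E3} (hy : inner ℝ (q : E3) y = 0) : sharp q (flat q y) = y :=
  eq_of_flat_eq q (inner_coe_sharp q _) hy (flat_sharp q _)

theorem dualInner_gbar (q : S2) (p₁ p₂ : CoT q) :
    dualInner (gbar q) p₁ p₂ = inner ℝ (sharp q p₁) (sharp q p₂) := by
  rw [dualInner, ← inner_sharp q p₁]; rfl

/-- The Euclidean plane. -/
abbrev E2 : Type := EuclideanSpace ℝ (Fin 2)

/-! ### Smoothness of covector fields and metrics given by Euclidean data -/

section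

variable {E : Type*} [NormedAddCommGroup E] [NormedSpace ℝ E]
  {H : Type*} [TopologicalSpace H] {I : ModelWithCorners ℝ E H}
  {M : Type*} [TopologicalSpace M] [ChartedSpace H M]

theorem contMDiffAt_precomp {V W : Type*} [NormedAddCommGroup V] [NormedSpace ℝ V]
    [NormedAddCommGroup W] [NormedSpace ℝ W] {A : M → V →L[ℝ] W} {m₀ : M}
    (hA : ContMDiffAt I 𝓘(ℝ, V →L[ℝ] W) ∞ A m₀) :
    ContMDiffAt I 𝓘(ℝ, (W →L[ℝ] ℝ) →L[ℝ] (V →L[ℝ] ℝ)) ∞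
      (fun m => ((A m).precomp ℝ : (W →L[ℝ] ℝ) →L[ℝ] (V →L[ℝ] ℝ))) m₀ := by
  have h : ContDiff ℝ ∞ (fun A : V →L[ℝ] W =>
      ((A.precomp ℝ : (W →L[ℝ] ℝ) →L[ℝ] (V →L[ℝ] ℝ)))) :=
    ContinuousLinearMap.contDiff (𝕜 := ℝ) (E := V →L[ℝ] W)
      (F := (W →L[ℝ] ℝ) →L[ℝ] (V →L[ℝ] ℝ)) (ContinuousLinearMap.compL ℝ V W ℝ).flip
  exact h.contMDiff.contMDiffAt.comp m₀ hA

theorem contMDiffAt_mk_flat {q : M → S2} {Y : M → E3} {m₀ : M}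
    (hq : ContMDiffAt I (𝓡 2) ∞ q m₀) (hY : ContMDiffAt I 𝓘(ℝ, E3) ∞ Y m₀) :
    ContMDiffAt I ICot ∞ (fun m => (⟨q m, flat (q m) (Y m)⟩ : CotS2)) m₀ := by
  refine (contMDiffAt_hom_bundle (E₂ := Bundle.Trivial S2 ℝ)
    (fun m => (⟨q m, flat (q m) (Y m)⟩ : CotS2))).2 ⟨hq, ?_⟩
  have hA := (inclCoord_contMDiffAt (q m₀)).comp m₀ hq
  have hi : ContMDiffAt I 𝓘(ℝ, E3 →L[ℝ] ℝ) ∞ (fun m => innerSL ℝ (Y m)) m₀ :=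
    (innerSL ℝ (E := E3)).contDiff.contMDiff.contMDiffAt.comp m₀ hY
  refine (hi.clm_comp hA).congr_of_eventuallyEq (Filter.Eventually.of_forall fun m => ?_)
  ext v
  simp [ContinuousLinearMap.inCoordinates]

/-- If $A$ is the differential of the inclusion in a trivialisation and $w$ the coordinate covector,
the dual vector is $A(A^TA)^{-1}w$; the Gram operator $A^TA$ is invertible because $A$ is injective,
and inversion of operators is smooth there. -/
theorem contMDiffAt_sharp {f : M → CotS2} {m₀ : M} (hf : ContMDiffAt I ICot ∞ f m₀) :
    ContMDiffAt I 𝓘(ℝ, E3) ∞ (fun m => sharp (f m).proj (f m).snd) m₀ := by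
  obtain ⟨hq, hp⟩ := (contMDiffAt_hom_bundle (E₂ := Bundle.Trivial S2 ℝ) f).1 hf
  have hA := (inclCoord_contMDiffAt (f m₀).proj).comp m₀ hq
  set A : M → E2 →L[ℝ] E3 := fun m => incl (f m).proj ∘L
    (trivializationAt E2 TS (f m₀).proj).symmL ℝ (f m).proj with hAdef
  change ContMDiffAt I 𝓘(ℝ, E2 →L[ℝ] E3) ∞ A m₀ at hA
  have hi : ContMDiffAt I 𝓘(ℝ, E2 →L[ℝ] E3 →L[ℝ] ℝ) ∞ (fun m => innerSL ℝ ∘L A m) m₀ :=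
    contMDiffAt_const.clm_comp hA
  have hAt : ContMDiffAt I 𝓘(ℝ, (E3 →L[ℝ] ℝ) →L[ℝ] (E2 →L[ℝ] ℝ)) ∞
      (fun m => (A m).precomp ℝ) m₀ :=
    contMDiffAt_precomp hA
  set G : M → E2 →L[ℝ] E2 →L[ℝ] ℝ := fun m => (A m).precomp ℝ ∘L innerSL ℝ ∘L A m with hG
  have hGs : ContMDiffAt I 𝓘(ℝ, E2 →L[ℝ] E2 →L[ℝ] ℝ) ∞ G m₀ := hAt.clm_comp hi
  have hbase : ∀ᶠ m in 𝓝 m₀, (f m).proj ∈ (trivializationAt E2 TS (f m₀).proj).baseSet :=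
    hq.continuousAt.preimage_mem_nhds
      ((trivializationAt E2 TS (f m₀).proj).open_baseSet.mem_nhds
        (FiberBundle.mem_baseSet_trivializationAt' (f m₀).proj))
  have hinv : ∀ m, (f m).proj ∈ (trivializationAt E2 TS (f m₀).proj).baseSet →
      (G m).IsInvertible := by
    intro m hm
    refine isInvertible_of_pos _ fun v hv => ?_
    change 0 < inner ℝ (A m v) (A m v)
    rw [real_inner_self_pos]
    intro h0
    have h1 : (trivializationAt E2 TS (f m₀).proj).symmL ℝ (f m).proj v = 0 :=
      incl_injective _ (by simpa [hAdef] using h0)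
    have h2 := (trivializationAt E2 TS (f m₀).proj).continuousLinearMapAt_symmL (R := ℝ) hm v
    rw [h1, map_zero] at h2
    exact hv h2.symm
  have hGi : ContMDiffAt I 𝓘(ℝ, (E2 →L[ℝ] ℝ) →L[ℝ] E2) ∞ (fun m => (G m).inverse) m₀ :=
    ((hinv m₀ hbase.self_of_nhds).contDiffAt_map_inverse.contMDiffAt).comp m₀ hGs
  refine (hA.clm_apply (hGi.clm_apply hp)).congr_of_eventuallyEq ?_
  filter_upwards [hbase] with m hm
  set w := ContinuousLinearMap.inCoordinates E2 TS ℝ (Bundle.Trivial S2 ℝ) (f m₀).proj (f m).proj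
    (f m₀).proj (f m).proj (f m).snd
  refine eq_of_flat_eq _ (inner_coe_sharp _ _) (inner_coe_incl _ _) ?_
  rw [flat_sharp]
  ext v
  obtain ⟨u, rfl⟩ : ∃ u, (trivializationAt E2 TS (f m₀).proj).symmL ℝ (f m).proj u = v :=
    ⟨_, (trivializationAt E2 TS (f m₀).proj).symmL_continuousLinearMapAt (R := ℝ) hm v⟩
  have h3 : G m ((G m).inverse w) = w := (hinv m hm).self_apply_inverse w
  have h4 := DFunLike.congr_fun h3 u
  change _ = inner ℝ (A m ((G m).inverse w)) (A m u)
  change inner ℝ (A m ((G m).inverse w)) (A m u) = _ at h4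
  rw [h4]
  simp [w, ContinuousLinearMap.inCoordinates]

theorem contMDiff_pullback_incl {B : S2 → E3 →L[ℝ] E3 →L[ℝ] ℝ}
    (hB : ContMDiff (𝓡 2) 𝓘(ℝ, E3 →L[ℝ] E3 →L[ℝ] ℝ) ∞ B) :
    ContMDiff (𝓡 2) ((𝓡 2).prod 𝓘(ℝ, E2 →L[ℝ] E2 →L[ℝ] ℝ)) ∞
      (fun q => Bundle.TotalSpace.mk' (E2 →L[ℝ] E2 →L[ℝ] ℝ)
        (E := fun q : S2 => TS q →L[ℝ] TS q →L[ℝ] ℝ) q ((incl q).precomp ℝ ∘L B q ∘L incl q)) := by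
  intro q₀
  refine (contMDiffAt_hom_bundle (E₁ := TS) (E₂ := CoT) _).2 ⟨contMDiffAt_id, ?_⟩
  have hA := (inclCoord_contMDiffAt q₀)
  set A : S2 → E2 →L[ℝ] E3 := fun q => incl q ∘L
    (trivializationAt E2 TS q₀).symmL ℝ q with hAdef
  have hAt : ContMDiffAt (𝓡 2) 𝓘(ℝ, (E3 →L[ℝ] ℝ) →L[ℝ] (E2 →L[ℝ] ℝ)) ∞
      (fun m => (A m).precomp ℝ) q₀ :=
    contMDiffAt_precomp hA
  refine (hAt.clm_comp ((hB q₀).clm_comp hA)).congr_of_eventuallyEq ?_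
  have hbase : ∀ᶠ q in 𝓝 q₀, q ∈ (trivializationAt E2 TS q₀).baseSet :=
      ((trivializationAt E2 TS q₀).open_baseSet.mem_nhds
        (FiberBundle.mem_baseSet_trivializationAt' q₀))
  filter_upwards [hbase] with m hm
  ext v w
  rw [inCoordinates_apply_eq₂ (E₁ := TS) (E₂ := TS) (E₃ := Bundle.Trivial S2 ℝ) hm hm (by simp)]
  simp [hAdef, Bundle.Trivialization.symmL_apply _ hm]
end

/-! ### The exterior derivative of a one-form $\langle b,da\rangle$ -/

section

variable {E : Type*} [NormedAddCommGroup E] [NormedSpace ℝ E]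
  {H : Type*} [TopologicalSpace H] {I : ModelWithCorners ℝ E H}
  {M : Type*} [TopologicalSpace M] [ChartedSpace H M]
  {E' : Type*} [NormedAddCommGroup E'] [NormedSpace ℝ E']
  {H' : Type*} [TopologicalSpace H'] {I' : ModelWithCorners ℝ E' H'}
  {M' : Type*} [TopologicalSpace M'] [ChartedSpace H' M']
  {V : Type*} [NormedAddCommGroup V] [InnerProductSpace ℝ V]

theorem mvfderiv_comp' {f : M → M'} {g : M' → V} {x : M}
    (hg : MDifferentiableAt I' 𝓘(ℝ, V) g (f x)) (hf : MDifferentiableAt I I' f x) :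
    mvfderiv I (fun y => g (f y)) x = mvfderiv I' g (f x) ∘L mfderiv I I' f x := by
  exact mfderiv_comp x hg hf

/-- The exterior derivative of the one-form `∑ bᵢ daᵢ` is `∑ dbᵢ ∧ daᵢ`. -/
theorem extD_oneForm_inner [I.Boundaryless] [IsManifold I ∞ M] {a b : M → V}
    (ha : ContMDiff I 𝓘(ℝ, V) ∞ a) (hb : ContMDiff I 𝓘(ℝ, V) ∞ b) (x : M)
    (ξ η : TangentSpace I x) :
    extD I (oneForm I fun x => innerSL ℝ (b x) ∘L mvfderiv I a x) x ![ξ, η] =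
      inner ℝ (mvfderiv I b x ξ) (mvfderiv I a x η) -
        inner ℝ (mvfderiv I b x η) (mvfderiv I a x ξ) := by
  set χ := extChartAt I x with hχ
  have htar : χ.target ∈ 𝓝 (χ x) := extChartAt_target_mem_nhds x
  have hopen : IsOpen χ.target := isOpen_extChartAt_target x
  have hχs : ContMDiffOn 𝓘(ℝ, E) I ∞ χ.symm χ.target := contMDiffOn_extChartAt_symm x
  have hsmooth : ∀ c : M → V, ContMDiff I 𝓘(ℝ, V) ∞ c →
      ContDiffOn ℝ ∞ (fun y => c (χ.symm y)) χ.target := fun c hc =>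
    contMDiffOn_iff_contDiffOn.1 (hc.comp_contMDiffOn hχs)
  have hchain : ∀ c : M → V, ContMDiff I 𝓘(ℝ, V) ∞ c → ∀ ζ : TangentSpace I x,
      fderiv ℝ (fun y => c (χ.symm y)) (χ x) (mvfderiv I χ x ζ) = mvfderiv I c x ζ := by
    intro c hc ζ
    have h1 : MDifferentiableAt 𝓘(ℝ, E) 𝓘(ℝ, V) (fun y => c (χ.symm y)) (χ x) :=
      (((hsmooth c hc).contDiffAt htar).differentiableAt (by simp)).mdifferentiableAt
    have h2 : MDifferentiableAt I 𝓘(ℝ, E) χ x := mdifferentiableAt_extChartAt (by simp)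
    have h3 : (fun y => c y) =ᶠ[𝓝 x] fun y => c (χ.symm (χ y)) := by
      filter_upwards [extChartAt_source_mem_nhds (I := I) x] with y hy
      rw [χ.left_inv hy]
    have h4 := mvfderiv_comp' h1 h2
    have h5 : mvfderiv I c x = mvfderiv I (fun y => c (χ.symm (χ y))) x := h3.mfderiv_eq
    have h6 : mvfderiv 𝓘(ℝ, E) (fun y => c (χ.symm y)) (χ x) =
        fderiv ℝ (fun y => c (χ.symm y)) (χ x) := mfderiv_eq_fderiv
    rw [h5, h4, h6]
    rfl
  have hder : ∀ y ∈ χ.target, mvfderiv I a (χ.symm y) ∘L (mfderiv 𝓘(ℝ, E) I χ.symm y ∘L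
          (NormedSpace.fromTangentSpace (𝕜 := ℝ) y).symm.toContinuousLinearMap) =
        fderiv ℝ (fun y => a (χ.symm y)) y := by
    intro y hy
    have h1 : MDifferentiableAt 𝓘(ℝ, E) I χ.symm y :=
      ((hχs.contMDiffAt (hopen.mem_nhds hy))).mdifferentiableAt (by simp)
    have h2 : MDifferentiableAt I 𝓘(ℝ, V) a (χ.symm y) := ha.mdifferentiableAt (by simp)
    have h4 := mvfderiv_comp' h2 h1
    rw [mvfderiv, mfderiv_eq_fderiv] at h4
    ext v
    exact (DFunLike.congr_fun h4 v).symm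
  have hA := (hsmooth a ha).contDiffAt htar
  have hB := (hsmooth b hb).contDiffAt htar
  set A : E → V := fun y => a (χ.symm y)
  set B : E → V := fun y => b (χ.symm y)
  -- The chart expression is needed on a whole neighbourhood, since it is about to be
  -- differentiated.
  have hω : (fun y : E => ((oneForm I fun x => innerSL ℝ (b x) ∘L mvfderiv I a x)
        (χ.symm y)).compContinuousLinearMap
        (mfderiv 𝓘(ℝ, E) I χ.symm y ∘L
          (NormedSpace.fromTangentSpace (𝕜 := ℝ) y).symm.toContinuousLinearMap)) =ᶠ[𝓝 (χ x)]
      fun y => ContinuousAlternatingMap.ofSubsingleton ℝ E ℝ (0 : Fin 1)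
        (innerSL ℝ (B y) ∘L fderiv ℝ A y) := by
    filter_upwards [htar] with y hy
    rw [← hder y hy]
    ext v
    rfl
  have hA1 : DifferentiableAt ℝ (fderiv ℝ A) (χ x) :=
    (hA.fderiv_right (m := 1) (by norm_cast)).differentiableAt (by simp)
  have hBd : DifferentiableAt ℝ B (χ x) := hB.differentiableAt (by simp)
  have hlin : DifferentiableAt ℝ (fun y => innerSL ℝ (B y) ∘L fderiv ℝ A y) (χ x) :=
    (((innerSL ℝ).differentiableAt).comp (χ x) hBd).clm_comp hA1
  have hd : DifferentiableAt ℝ (fun y => ContinuousAlternatingMap.ofSubsingleton ℝ E ℝ (0 : Fin 1)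
        (innerSL ℝ (B y) ∘L fderiv ℝ A y)) (χ x) := by
    exact (ContinuousAlternatingMap.ofSubsingletonLIE (𝕜 := ℝ) (E := E) (F := ℝ)
      (0 : Fin 1)).differentiableAt.comp (χ x) hlin
  have hcalc : ∀ u w : E, fderiv ℝ (fun y => inner ℝ (B y) (fderiv ℝ A y w)) (χ x) u =
      inner ℝ (fderiv ℝ B (χ x) u) (fderiv ℝ A (χ x) w) +
        inner ℝ (B (χ x)) (fderiv ℝ (fderiv ℝ A) (χ x) u w) := by
    intro u w
    rw [fderiv_inner_apply ℝ hBd (hA1.clm_apply (differentiableAt_const w)), add_comm]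
    congr 2
    rw [fderiv_clm_apply hA1 (differentiableAt_const w)]
    simp
  have hsym := (hA.isSymmSndFDerivAt (by
    rw [minSmoothness_of_isRCLikeNormedField]; exact WithTop.coe_le_coe.2 (le_top (a := (2 : ℕ∞)))))
  unfold extD
  rw [ContinuousAlternatingMap.compContinuousLinearMap_apply, hω.extDeriv_eq, extDeriv_apply hd,
    Fin.sum_univ_two]
  have e0 : ∀ u w : E, fderiv ℝ (fun y => ContinuousAlternatingMap.ofSubsingleton ℝ E ℝ (0 : Fin 1)
        (innerSL ℝ (B y) ∘L fderiv ℝ A y) ![w]) (χ x) u = _ := hcalc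
  have r0 : ∀ u w : E, Fin.removeNth 0 ![u, w] = ![w] := by
    intro u w; ext i; fin_cases i; rfl
  have r1 : ∀ u w : E, Fin.removeNth 1 ![u, w] = ![u] := by
    intro u w; ext i; fin_cases i; rfl
  have hm : ∀ f : TangentSpace I x →L[ℝ] E, (⇑f ∘ ![ξ, η]) = ![f ξ, f η] := by
    intro f; ext i; fin_cases i <;> rfl
  rw [hm, r0, r1, e0, e0]
  -- The terms $\langle B,d^2A\rangle$ cancel by the symmetry of the second derivative.
  have := hsym.eq (mvfderiv I χ x ξ) (mvfderiv I χ x η)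
  simp only [Matrix.cons_val_zero, Matrix.cons_val_one]
  rw [← hχ, this, hchain a ha, hchain a ha, hchain b hb, hchain b hb]
  simp only [Fin.val_zero, pow_zero, one_smul, Fin.val_one, pow_one, neg_smul]
  ring

end

/-! ### The twisted symplectic form in terms of position and momentum -/

instance : IsManifold ICot ∞ CotS2 :=
  Bundle.TotalSpace.isManifold (n := ∞) CotFibre (fun q : S2 => TS q →L[ℝ] Bundle.Trivial S2 ℝ q)

theorem contMDiff_proj : ContMDiff ICot (𝓡 2) ∞ (Bundle.TotalSpace.proj : CotS2 → S2) :=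
  Bundle.contMDiff_proj CoT

/-- The base point of a covector, as a vector of Euclidean space. -/
def pos (z : CotS2) : E3 := (z.proj : E3)

/-- The momentum of a covector, as a vector of Euclidean space. -/
def mom (z : CotS2) : E3 := sharp z.proj z.snd

theorem contMDiff_coe : ContMDiff (𝓡 2) 𝓘(ℝ, E3) ∞ (fun q : S2 => (q : E3)) :=
  contMDiff_coe_sphere (n := 2)

theorem contMDiff_pos : ContMDiff ICot 𝓘(ℝ, E3) ∞ pos := contMDiff_coe.comp contMDiff_proj

theorem contMDiff_mom : ContMDiff ICot 𝓘(ℝ, E3) ∞ mom := fun _ =>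
  contMDiffAt_sharp contMDiffAt_id

theorem mdiff_pos (z : CotS2) : MDifferentiableAt ICot 𝓘(ℝ, E3) pos z :=
  contMDiff_pos.mdifferentiableAt (by simp)

theorem mdiff_mom (z : CotS2) : MDifferentiableAt ICot 𝓘(ℝ, E3) mom z :=
  contMDiff_mom.mdifferentiableAt (by simp)

theorem mdiff_proj (z : CotS2) :
    MDifferentiableAt ICot (𝓡 2) (Bundle.TotalSpace.proj : CotS2 → S2) z :=
  contMDiff_proj.mdifferentiableAt (by simp)

theorem mvfderiv_pos (z : CotS2) : mvfderiv ICot pos z =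
    incl z.proj ∘L mfderiv ICot (𝓡 2) (Bundle.TotalSpace.proj : CotS2 → S2) z :=
  mvfderiv_comp' (contMDiff_coe.mdifferentiableAt (by simp)) (mdiff_proj z)

theorem liouville_eq : liouville =
    oneForm ICot fun z => innerSL ℝ (mom z) ∘L mvfderiv ICot pos z := by
  rw [liouville]
  congr 1
  ext z ξ
  rw [mvfderiv_pos]
  exact (inner_sharp z.proj z.snd _).symm

theorem twisted_apply (σ : Form (𝓡 2) S2 2) (z : CotS2) (ξ η : TangentSpace ICot z) :
    twisted σ z ![ξ, η] =
      inner ℝ (mvfderiv ICot mom z ξ) (mvfderiv ICot pos z η) -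
        inner ℝ (mvfderiv ICot mom z η) (mvfderiv ICot pos z ξ) -
      σ z.proj ![mfderiv ICot (𝓡 2) (Bundle.TotalSpace.proj : CotS2 → S2) z ξ,
        mfderiv ICot (𝓡 2) (Bundle.TotalSpace.proj : CotS2 → S2) z η] := by
  rw [← extD_oneForm_inner contMDiff_pos contMDiff_mom, ← liouville_eq]
  have h : (mfderiv ICot (𝓡 2) (Bundle.TotalSpace.proj : CotS2 → S2) z) ∘ ![ξ, η] =
    ![mfderiv ICot (𝓡 2) (Bundle.TotalSpace.proj : CotS2 → S2) z ξ,
        mfderiv ICot (𝓡 2) (Bundle.TotalSpace.proj : CotS2 → S2) z η] := by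
    ext i; fin_cases i <;> rfl
  rw [← h]
  rfl

section
variable {E : Type*} [NormedAddCommGroup E] [NormedSpace ℝ E]
  {H : Type*} [TopologicalSpace H] {I : ModelWithCorners ℝ E H}
  {M : Type*} [TopologicalSpace M] [ChartedSpace H M]
  {V : Type*} [NormedAddCommGroup V] [InnerProductSpace ℝ V]

theorem mvfderiv_comp_hasFDerivAt {W : Type*} [NormedAddCommGroup W] [NormedSpace ℝ W]
    {V : Type*} [NormedAddCommGroup V] [NormedSpace ℝ V]
    {f : M → V} {x : M} {g : V → W} {g' : V →L[ℝ] W} (hg : HasFDerivAt g g' (f x))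
    (hf : MDifferentiableAt I 𝓘(ℝ, V) f x) (ξ : TangentSpace I x) :
    mvfderiv I (fun y => g (f y)) x ξ = g' (mvfderiv I f x ξ) :=
  DFunLike.congr_fun (hg.hasMFDerivAt.comp x hf.hasMFDerivAt).mfderiv ξ

theorem mvfderiv_prodMk {V : Type*} [NormedAddCommGroup V] [NormedSpace ℝ V]
    {W : Type*} [NormedAddCommGroup W] [NormedSpace ℝ W] {a : M → V} {b : M → W} {x : M}
    (ha : MDifferentiableAt I 𝓘(ℝ, V) a x) (hb : MDifferentiableAt I 𝓘(ℝ, W) b x)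
    (ξ : TangentSpace I x) :
    mvfderiv I (fun y => (a y, b y)) x ξ = ((mvfderiv I a x ξ, mvfderiv I b x ξ) : V × W) :=
  Prod.ext (mvfderiv_comp_hasFDerivAt hasFDerivAt_fst (ha.prodMk_space hb) ξ).symm
    (mvfderiv_comp_hasFDerivAt hasFDerivAt_snd (ha.prodMk_space hb) ξ).symm

theorem mvfderiv_inner {a b : M → V} {x : M} (ha : MDifferentiableAt I 𝓘(ℝ, V) a x)
    (hb : MDifferentiableAt I 𝓘(ℝ, V) b x) (ξ : TangentSpace I x) :
    mvfderiv I (fun y => inner ℝ (a y) (b y)) x ξ =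
      inner ℝ (a x) (mvfderiv I b x ξ) + inner ℝ (mvfderiv I a x ξ) (b x) := by
  have h1 : HasFDerivAt (fun p : V × V => (inner ℝ p.1 p.2 : ℝ)) _ (a x, b x) :=
    hasFDerivAt_fst.inner ℝ hasFDerivAt_snd
  rw [mvfderiv_comp_hasFDerivAt (f := fun y => (a y, b y)) h1 (ha.prodMk_space hb),
    mvfderiv_prodMk ha hb]
  simp

end

theorem inner_pos_mom (z : CotS2) : inner ℝ (pos z) (mom z) = 0 := inner_coe_sharp _ _

theorem inner_pos_pos (z : CotS2) : inner ℝ (pos z) (pos z) = 1 := by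
  rw [real_inner_self_eq_norm_sq]; simp [pos]

theorem inner_pos_dpos (z : CotS2) (ξ : TangentSpace ICot z) :
    inner ℝ (pos z) (mvfderiv ICot pos z ξ) = 0 := by
  rw [mvfderiv_pos]
  exact inner_coe_incl _ _

/-- Differentiate the constraint $\langle q,P\rangle=0$. -/
theorem inner_pos_dmom (z : CotS2) (ξ : TangentSpace ICot z) :
    inner ℝ (pos z) (mvfderiv ICot mom z ξ) + inner ℝ (mvfderiv ICot pos z ξ) (mom z) = 0 := by
  rw [← mvfderiv_inner (mdiff_pos z) (mdiff_mom z)]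
  have : (fun y => inner ℝ (pos y) (mom y)) = fun _ => 0 := funext inner_pos_mom
  rw [this, mvfderiv_const]
  rfl

/-- Through every covector there passes a smooth section of the cotangent bundle. -/
theorem exists_lift (z : CotS2) (v : TS z.proj) : ∃ ξ : TangentSpace ICot z,
    mfderiv ICot (𝓡 2) (Bundle.TotalSpace.proj : CotS2 → S2) z ξ = v := by
  set S : S2 → CotS2 := fun q => ⟨q, flat q (mom z)⟩
  have hS : S z.proj = z := by
    ext1
    · rfl
    · exact heq_of_eq (flat_sharp _ _)
  have h1 : MDifferentiableAt (𝓡 2) ICot S z.proj :=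
    (contMDiffAt_mk_flat contMDiffAt_id contMDiffAt_const).mdifferentiableAt (by simp)
  have h2 := mfderiv_comp (I' := ICot) (I'' := 𝓡 2) z.proj (g := (Bundle.TotalSpace.proj : CotS2 → S2)) (mdiff_proj _) h1
  have h3 : (Bundle.TotalSpace.proj : CotS2 → S2) ∘ S = id := rfl
  rw [h3, mfderiv_id] at h2
  rw [hS] at h2
  exact ⟨mfderiv (𝓡 2) ICot S z.proj v, (DFunLike.congr_fun h2 v).symm⟩

/-- Moving the covector inside its fibre by the restriction of $\langle y,\cdot\rangle$ changes the
momentum by the tangential part of $y$; `L` is the derivative of this family at $y=0$. -/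
theorem exists_vertical (z : CotS2) : ∃ L : E3 →L[ℝ] TangentSpace ICot z, ∀ y,
    mfderiv ICot (𝓡 2) (Bundle.TotalSpace.proj : CotS2 → S2) z (L y) = 0 ∧
    mvfderiv ICot mom z (L y) = y - inner ℝ (pos z) y • pos z := by
  set S : E3 → CotS2 := fun y => ⟨z.proj, flat z.proj (mom z + y)⟩
  have hS : S 0 = z := by
    ext1
    · rfl
    · refine heq_of_eq ?_
      change flat _ (mom z + 0) = _
      rw [add_zero]
      exact flat_sharp _ _
  have h1 : MDifferentiableAt 𝓘(ℝ, E3) ICot S 0 :=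
    (contMDiffAt_mk_flat contMDiffAt_const
      (contDiff_const.add contDiff_id).contMDiff.contMDiffAt).mdifferentiableAt (by simp)
  have h2 := mfderiv_comp (I' := ICot) (I'' := 𝓡 2) (0 : E3) (g := (Bundle.TotalSpace.proj : CotS2 → S2)) (mdiff_proj _) h1
  have h3 : (Bundle.TotalSpace.proj : CotS2 → S2) ∘ S = fun _ => z.proj := rfl
  rw [h3, mfderiv_const, hS] at h2
  have h4 := mvfderiv_comp' (mdiff_mom _) h1
  have h5 : (fun y => mom (S y)) = fun y => mom z + (y - inner ℝ (pos z) y • pos z) := by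
    funext y
    refine eq_of_flat_eq z.proj (inner_coe_sharp _ _) ?_ ?_
    · change inner ℝ (pos z) _ = 0
      rw [inner_add_right, inner_pos_mom, inner_sub_right, inner_smul_right, inner_pos_pos]
      ring
    · change flat _ (sharp _ (flat _ _)) = _
      rw [flat_sharp]
      ext v
      simp only [flat_apply, inner_add_left, inner_sub_left, inner_smul_left]
      rw [show inner ℝ (pos z) (incl z.proj v) = 0 from inner_coe_incl _ _]
      simp
      rfl
  rw [h5, hS] at h4
  refine ⟨mfderiv 𝓘(ℝ, E3) ICot S 0, fun y => ⟨(DFunLike.congr_fun h2 y).symm, ?_⟩⟩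
  have h6 : mvfderiv 𝓘(ℝ, E3) (fun y => mom z + (y - inner ℝ (pos z) y • pos z)) 0 =
    fderiv ℝ (fun y => mom z + (y - inner ℝ (pos z) y • pos z)) 0 := mfderiv_eq_fderiv
  rw [h6] at h4
  have h7 : HasFDerivAt (fun y => mom z + (y - inner ℝ (pos z) y • pos z))
      (ContinuousLinearMap.id ℝ E3 - (innerSL ℝ (pos z)).smulRight (pos z)) 0 :=
    (((ContinuousLinearMap.id ℝ E3 - (innerSL ℝ (pos z)).smulRight (pos z)).hasFDerivAt).const_add
      (mom z))
  rw [h7.fderiv] at h4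
  exact (DFunLike.congr_fun h4 y).symm

theorem finrank_tangentSpace_cotS2 (z : CotS2) : Module.finrank ℝ (TangentSpace ICot z) = 4 := by
  change Module.finrank ℝ (EuclideanSpace ℝ (Fin 2) × CotFibre) = 4
  have e : (EuclideanSpace ℝ (Fin 2) →ₗ[ℝ] ℝ) ≃ₗ[ℝ] CotFibre := LinearMap.toContinuousLinearMap
  rw [Module.finrank_prod, ← e.finrank_eq,
    show Module.finrank ℝ (EuclideanSpace ℝ (Fin 2) →ₗ[ℝ] ℝ) = _ from
      Subspace.dual_finrank_eq (K := ℝ) (V := EuclideanSpace ℝ (Fin 2))]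
  simp

/-- If `A : X → Y` is onto and `B` maps the kernel of `A` onto a space containing `W`, where
`dim W + dim Y = dim X`, then `(A, B)` is injective. -/
theorem eq_zero_of_surjective_of_le {X Y Z : Type*} [AddCommGroup X] [Module ℝ X]
    [AddCommGroup Y] [Module ℝ Y] [AddCommGroup Z] [Module ℝ Z] [FiniteDimensional ℝ X]
    [FiniteDimensional ℝ Z] (A : X →ₗ[ℝ] Y) (B : X →ₗ[ℝ] Z) (hA : Function.Surjective A)
    (W : Submodule ℝ Z) (hW : ∀ w ∈ W, ∃ x, A x = 0 ∧ B x = w)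
    (hdim : Module.finrank ℝ X ≤ Module.finrank ℝ W + Module.finrank ℝ Y) {x : X}
    (hAx : A x = 0) (hBx : B x = 0) : x = 0 := by
  have h3 := LinearMap.finrank_range_add_finrank_ker A
  rw [LinearMap.range_eq_top.2 hA, finrank_top] at h3
  set f : LinearMap.ker A →ₗ[ℝ] Z := B ∘ₗ (LinearMap.ker A).subtype
  have hle : W ≤ LinearMap.range f := by
    intro w hw
    obtain ⟨y, hy, rfl⟩ := hW w hw
    exact ⟨⟨y, hy⟩, rfl⟩
  have h5 := Submodule.finrank_mono hle
  have h6 := LinearMap.finrank_range_add_finrank_ker f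
  have h8 : LinearMap.ker f = ⊥ := Submodule.finrank_eq_zero.1 (by omega)
  have h9 : (⟨x, hAx⟩ : LinearMap.ker A) ∈ LinearMap.ker f := hBx
  rw [h8, Submodule.mem_bot] at h9
  exact congrArg Subtype.val h9

/-- A dimension count: the projection takes the four-dimensional tangent space onto a plane, and
vertical vectors already realise every momentum change in the plane orthogonal to $q$. Thus position
and momentum together form an immersion. -/
theorem eq_zero_of_dpos_dmom (z : CotS2) (ξ : TangentSpace ICot z)
    (h₁ : mvfderiv ICot pos z ξ = 0) (h₂ : mvfderiv ICot mom z ξ = 0) : ξ = 0 := by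
  have hv : mfderiv ICot (𝓡 2) (Bundle.TotalSpace.proj : CotS2 → S2) z ξ = 0 := by
    rw [mvfderiv_pos] at h₁
    exact incl_injective z.proj (by simpa using h₁)
  obtain ⟨L, hL⟩ := exists_vertical z
  have : FiniteDimensional ℝ (TangentSpace ICot z) :=
    inferInstanceAs (FiniteDimensional ℝ (EuclideanSpace ℝ (Fin 2) × CotFibre))
  have hpos : pos z ≠ 0 := fun h => by simpa [h] using inner_pos_pos z
  refine eq_zero_of_surjective_of_le
    (A := (mfderiv ICot (𝓡 2) (Bundle.TotalSpace.proj : CotS2 → S2) z).toLinearMap)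
    (B := (mvfderiv ICot mom z).toLinearMap) (exists_lift z) (ℝ ∙ pos z)ᗮ ?_ ?_ hv h₂
  · intro y hy
    rw [Submodule.mem_orthogonal_singleton_iff_inner_right] at hy
    refine ⟨L y, (hL y).1, (hL y).2.trans ?_⟩
    rw [hy, zero_smul, sub_zero]
  · rw [finrank_tangentSpace_cotS2, Submodule.finrank_orthogonal_span_singleton (n := 2) hpos]
    change 4 ≤ 2 + Module.finrank ℝ (EuclideanSpace ℝ (Fin 2))
    simp

/-- The magnetic term vanishes as soon as one argument is vertical. Testing against the vertical
vector with momentum change $dq(\xi)$ gives $|dq(\xi)|^2=0$; then $dP(\xi)$ is itself tangent to the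
sphere, and testing against a lift of it gives $|dP(\xi)|^2=0$. -/
theorem twisted_nondegenerate (σ : Form (𝓡 2) S2 2) (z : CotS2) (ξ : TangentSpace ICot z)
    (h : ∀ η, twisted σ z ![ξ, η] = 0) : ξ = 0 := by
  have hvert : mvfderiv ICot pos z ξ = 0 := by
    obtain ⟨L, hL⟩ := exists_vertical z
    have h1 := h (L (mvfderiv ICot pos z ξ))
    have h2 : mvfderiv ICot pos z (L (mvfderiv ICot pos z ξ)) = 0 := by
      rw [mvfderiv_pos, ContinuousLinearMap.comp_apply, (hL _).1, map_zero]
    have h3 : σ z.proj ![mfderiv ICot (𝓡 2) (Bundle.TotalSpace.proj : CotS2 → S2) z ξ, 0] = 0 :=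
      (σ z.proj).map_coord_zero (1 : Fin 2) rfl
    rw [twisted_apply, h2, (hL _).1, (hL _).2, inner_pos_dpos, h3] at h1
    simpa using h1
  have hv : mfderiv ICot (𝓡 2) (Bundle.TotalSpace.proj : CotS2 → S2) z ξ = 0 := by
    have h₁ := hvert
    rw [mvfderiv_pos] at h₁
    exact incl_injective z.proj (by simpa using h₁)
  refine eq_zero_of_dpos_dmom z ξ hvert ?_
  have h0 : inner ℝ (pos z) (mvfderiv ICot mom z ξ) = 0 := by
    simpa [hvert] using inner_pos_dmom z ξ
  obtain ⟨v, hv'⟩ := (mem_range_incl z.proj _).2 h0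
  obtain ⟨η, rfl⟩ := exists_lift z v
  have h1 := h η
  have h3 : σ z.proj ![0, mfderiv ICot (𝓡 2) (Bundle.TotalSpace.proj : CotS2 → S2) z η] = 0 :=
    (σ z.proj).map_coord_zero (0 : Fin 2) rfl
  have h2 : mvfderiv ICot pos z η = mvfderiv ICot mom z ξ := by
    rw [mvfderiv_pos]; exact hv'
  rw [twisted_apply, hv, h3, hvert, h2] at h1
  simpa using h1

/-! ### Rotations of Euclidean space and the explicit orbits -/

/-- The cross product. -/
def cr (x y : E3) : E3 := !₂[x 1 * y 2 - x 2 * y 1, x 2 * y 0 - x 0 * y 2, x 0 * y 1 - x 1 * y 0]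

/-- The infinitesimal rotation around the third axis. -/
def rot : E3 →L[ℝ] E3 := LinearMap.toContinuousLinearMap
  { toFun := fun x => !₂[-x 1, x 0, 0]
    map_add' := fun x y => by ext i; fin_cases i <;> simp; ring
    map_smul' := fun c x => by ext i; fin_cases i <;> simp }

/-- The projection to the third axis. -/
def vert : E3 →L[ℝ] E3 := LinearMap.toContinuousLinearMap
  { toFun := fun x => !₂[0, 0, x 2]
    map_add' := fun x y => by ext i; fin_cases i <;> simp
    map_smul' := fun c x => by ext i; fin_cases i <;> simp }

theorem inner_eq (x y : E3) : inner ℝ x y = x 0 * y 0 + x 1 * y 1 + x 2 * y 2 := by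
  rw [PiLp.inner_apply, Fin.sum_univ_three]; simp; ring

@[simp] theorem rot_zero (x : E3) : rot x 0 = -x 1 := rfl
@[simp] theorem rot_one (x : E3) : rot x 1 = x 0 := rfl
@[simp] theorem rot_two (x : E3) : rot x 2 = 0 := rfl
@[simp] theorem vert_zero (x : E3) : vert x 0 = 0 := rfl
@[simp] theorem vert_one (x : E3) : vert x 1 = 0 := rfl
@[simp] theorem vert_two (x : E3) : vert x 2 = x 2 := rfl
@[simp] theorem cr_zero (x y : E3) : cr x y 0 = x 1 * y 2 - x 2 * y 1 := rfl
@[simp] theorem cr_one (x y : E3) : cr x y 1 = x 2 * y 0 - x 0 * y 2 := rfl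
@[simp] theorem cr_two (x y : E3) : cr x y 2 = x 0 * y 1 - x 1 * y 0 := rfl

theorem E3_ext {x y : E3} (h₀ : x 0 = y 0) (h₁ : x 1 = y 1) (h₂ : x 2 = y 2) : x = y := by
  ext i; fin_cases i <;> assumption

theorem cr_cr_left {q P : E3} (hq : inner ℝ q q = 1) (hqP : inner ℝ q P = 0) :
    cr q (cr q P) = -P := by
  rw [inner_eq] at hq hqP
  apply E3_ext <;> simp
  · linear_combination q 0 * hqP - P 0 * hq
  · linear_combination q 1 * hqP - P 1 * hq
  · linear_combination q 2 * hqP - P 2 * hq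

theorem cr_cr_right {q P : E3} (hqP : inner ℝ q P = 0) :
    cr P (cr q P) = inner ℝ P P • q := by
  rw [inner_eq] at *
  apply E3_ext <;> simp
  · linear_combination -P 0 * hqP
  · linear_combination -P 1 * hqP
  · linear_combination -P 2 * hqP

theorem cr_combination (q P m : E3) (x y w x' y' w' : ℝ) :
    cr (x • q + y • P + w • m) (x' • q + y' • P + w' • m) =
      (x * y' - y * x') • cr q P + (x * w' - w * x') • cr q m + (y * w' - w * y') • cr P m := by
  apply E3_ext <;> simp <;> ring

/-- The vectors $q$, $P$, $q\times P$ are mutually orthogonal, of squared lengths $1$, $|P|^2$,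
$|P|^2$. -/
theorem inner_combination {q P : E3} (hq : inner ℝ q q = 1) (hqP : inner ℝ q P = 0)
    (x y w x' y' w' : ℝ) :
    inner ℝ (x • q + y • P + w • cr q P) (x' • q + y' • P + w' • cr q P) =
      x * x' + (y * y' + w * w') * inner ℝ P P := by
  simp only [inner_eq] at *
  simp only [PiLp.add_apply, PiLp.smul_apply, smul_eq_mul, cr_zero, cr_one, cr_two]
  linear_combination (x * x' + w * w' * (P 0 * P 0 + P 1 * P 1 + P 2 * P 2)) * hq +
    (x * y' + y * x' - w * w' * (q 0 * P 0 + q 1 * P 1 + q 2 * P 2)) * hqP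

/-- The rotation around the third axis by the angle with cosine `c` and sine `d`. -/
def rotBy (c d : ℝ) (x : E3) : E3 := c • x + d • rot x + (1 - c) • vert x

theorem rotBy_inner {c d : ℝ} (h : c ^ 2 + d ^ 2 = 1) (x y : E3) : inner ℝ (rotBy c d x) (rotBy c d y) = inner ℝ x y := by
  simp only [inner_eq, rotBy, PiLp.add_apply, PiLp.smul_apply, smul_eq_mul, rot_zero, rot_one,
    rot_two, vert_zero, vert_one, vert_two]
  linear_combination (x 0 * y 0 + x 1 * y 1) * h

theorem rotBy_cr {c d : ℝ} (h : c ^ 2 + d ^ 2 = 1) (x y : E3) : cr (rotBy c d x) (rotBy c d y) = rotBy c d (cr x y) := by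
  apply E3_ext <;> simp [rotBy]
  · ring
  · ring
  · linear_combination (x 0 * y 1 - x 1 * y 0) * h

theorem rotBy_two (c d : ℝ) (x : E3) : rotBy c d x 2 = x 2 := by simp [rotBy]; ring

theorem rotBy_smul_add (c d u v : ℝ) (x y : E3) :
    rotBy c d (u • x + v • y) = u • rotBy c d x + v • rotBy c d y := by
  apply E3_ext <;> simp [rotBy] <;> ring

theorem inner_rot (q P : E3) : inner ℝ P (rot q) = cr q P 2 := by
  simp [inner_eq]; ring

theorem hasDerivAt_rotBy (α : ℝ) {a : ℝ → E3} {a' : E3} {t : ℝ} (h : HasDerivAt a a' t) :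
    HasDerivAt (fun t => rotBy (Real.cos (α * t)) (Real.sin (α * t)) (a t))
      (rotBy (Real.cos (α * t)) (Real.sin (α * t)) a' +
        α • rot (rotBy (Real.cos (α * t)) (Real.sin (α * t)) (a t))) t := by
  have hl : HasDerivAt (fun t => α * t) α t := by simpa using (hasDerivAt_id t).const_mul α
  have hc := hl.cos
  have hs := hl.sin
  have h1 := ((hc.smul h).add (hs.smul (rot.hasFDerivAt.comp_hasDerivAt t h))).add
    ((hc.const_sub 1).smul (vert.hasFDerivAt.comp_hasDerivAt t h))
  refine h1.congr_deriv ?_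
  apply E3_ext <;> simp [rotBy] <;> ring

/-- For $\alpha=0$ the vector $J=a\times b+sa$ is conserved and the system reads $a'=\frac1RJ\times
a$, $b'=\frac1RJ\times b$: a rotation at unit speed about $J/R$. A rotation about the third axis by
the angle $\alpha t$ respects inner and cross products, and composing with it produces the terms in
$\alpha$. -/
theorem exists_orbit {q P : E3} (hq : inner ℝ q q = 1) (hqP : inner ℝ q P = 0) (s α : ℝ) {R : ℝ}
    (hR : 0 < R) (hR2 : R ^ 2 = inner ℝ P P + s ^ 2) :
    ∃ a b : ℝ → E3, ContDiff ℝ ∞ a ∧ ContDiff ℝ ∞ b ∧ a 0 = q ∧ b 0 = P ∧ ∀ t,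
      inner ℝ (a t) (a t) = 1 ∧ inner ℝ (a t) (b t) = 0 ∧ inner ℝ (b t) (b t) = inner ℝ P P ∧
      inner ℝ (b t) (rot (a t)) + s * a t 2 = inner ℝ P (rot q) + s * q 2 ∧
      HasDerivAt a ((1 / R) • b t + α • rot (a t)) t ∧
      HasDerivAt b ((1 / R) • (s • cr (a t) (b t) - inner ℝ P P • a t) + α • rot (b t)) t := by
  set ρ : ℝ := inner ℝ P P with hρ
  set m := cr q P with hm
  -- Rodrigues' formula for the rotation about $(m+sq)/R$, applied to $q$ and, for `b₀`, to $P$.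
  set a₀ : ℝ → E3 := fun t => (Real.cos t + (1 - Real.cos t) * (s ^ 2 / R ^ 2)) • q +
    (Real.sin t * (1 / R)) • P + ((1 - Real.cos t) * (s / R ^ 2)) • m with ha₀
  set b₀ : ℝ → E3 := fun t => (Real.sin t * (-ρ / R)) • q + Real.cos t • P +
    (Real.sin t * (s / R)) • m with hb₀
  have hρR : ρ = R ^ 2 - s ^ 2 := by rw [hR2]; ring
  have haa : ∀ t, inner ℝ (a₀ t) (a₀ t) = 1 := by
    intro t
    rw [ha₀, inner_combination hq hqP, ← hρ, hρR]
    have := Real.sin_sq_add_cos_sq t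
    field_simp
    linear_combination (R ^ 4 - R ^ 2 * s ^ 2) * this
  have hab : ∀ t, inner ℝ (a₀ t) (b₀ t) = 0 := by
    intro t
    rw [ha₀, hb₀, inner_combination hq hqP, ← hρ, hρR]
    field_simp
    ring
  have hbb : ∀ t, inner ℝ (b₀ t) (b₀ t) = ρ := by
    intro t
    rw [hb₀, inner_combination hq hqP, ← hρ, hρR]
    have := Real.sin_sq_add_cos_sq t
    field_simp
    linear_combination (R ^ 2 - s ^ 2) * R ^ 2 * this
  -- Conservation of $J$.
  have hJ : ∀ t, cr (a₀ t) (b₀ t) = m + s • q - s • a₀ t := by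
    intro t
    have := Real.sin_sq_add_cos_sq t
    simp only [ha₀, hb₀]
    rw [cr_combination, ← hm, hm, cr_cr_left hq hqP, cr_cr_right hqP, ← hρ, ← hm, hρR]
    generalize Real.sin t = S at *
    generalize Real.cos t = C at *
    have e1 : (C + (1 - C) * (s ^ 2 / R ^ 2)) * C - S * (1 / R) * (S * (-(R ^ 2 - s ^ 2) / R)) =
        1 - s * ((1 - C) * (s / R ^ 2)) := by
      field_simp
      linear_combination (R ^ 2 - s ^ 2) * this
    have e2 : (C + (1 - C) * (s ^ 2 / R ^ 2)) * (S * (s / R)) -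
        (1 - C) * (s / R ^ 2) * (S * (-(R ^ 2 - s ^ 2) / R)) = s * (S * (1 / R)) := by
      field_simp
      ring
    have e3 : (S * (1 / R) * (S * (s / R)) - (1 - C) * (s / R ^ 2) * C) * (R ^ 2 - s ^ 2) =
        s - s * (C + (1 - C) * (s ^ 2 / R ^ 2)) := by
      field_simp
      linear_combination s * (R ^ 2 - s ^ 2) * this
    rw [e1, e2, smul_smul, e3]
    module
  have hda : ∀ t, HasDerivAt a₀ ((1 / R) • b₀ t) t := by
    intro t
    have hc := Real.hasDerivAt_cos t
    have hs := Real.hasDerivAt_sin t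
    have h1 := (((hc.add ((hc.const_sub 1).mul_const (s ^ 2 / R ^ 2))).smul_const q).add
      ((hs.mul_const (1 / R)).smul_const P)).add
      (((hc.const_sub 1).mul_const (s / R ^ 2)).smul_const m)
    refine h1.congr_deriv ?_
    rw [hb₀, hρR]
    match_scalars <;> field_simp <;> ring
  have hdb : ∀ t, HasDerivAt b₀ ((1 / R) • (s • cr (a₀ t) (b₀ t) - ρ • a₀ t)) t := by
    intro t
    have hc := Real.hasDerivAt_cos t
    have hs := Real.hasDerivAt_sin t
    have h1 := (((hs.mul_const (-ρ / R)).smul_const q).add (hc.smul_const P)).add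
      ((hs.mul_const (s / R)).smul_const m)
    refine h1.congr_deriv ?_
    rw [hJ, ha₀, hρR]
    match_scalars <;> field_simp <;> ring
  have hcs : ∀ t, Real.cos (α * t) ^ 2 + Real.sin (α * t) ^ 2 = 1 := fun t =>
    Real.cos_sq_add_sin_sq _
  refine ⟨fun t => rotBy (Real.cos (α * t)) (Real.sin (α * t)) (a₀ t),
    fun t => rotBy (Real.cos (α * t)) (Real.sin (α * t)) (b₀ t), ?_, ?_, ?_, ?_, fun t =>
    ⟨?_, ?_, ?_, ?_, ?_, ?_⟩⟩
  · simp only [rotBy, ha₀]; fun_prop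
  · simp only [rotBy, hb₀]; fun_prop
  · simp [rotBy, ha₀]
  · simp [rotBy, hb₀]
  · rw [rotBy_inner (hcs t), haa]
  · rw [rotBy_inner (hcs t), hab]
  · rw [rotBy_inner (hcs t), hbb]
  -- $\Omega_s$ is the third component of $J$, which the rotation about the third axis leaves alone.
  · rw [inner_rot, inner_rot, rotBy_cr (hcs t), rotBy_two, rotBy_two, hJ]
    simp [hm]
  · refine (hasDerivAt_rotBy α (hda t)).congr_deriv ?_
    have := rotBy_smul_add (Real.cos (α * t)) (Real.sin (α * t)) (1 / R) 0 (b₀ t) 0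
    simp only [zero_smul, add_zero] at this
    rw [this]
  · refine (hasDerivAt_rotBy α (hdb t)).congr_deriv ?_
    rw [rotBy_cr (hcs t)]
    have := rotBy_smul_add (Real.cos (α * t)) (Real.sin (α * t)) (1 / R * s) (-(1 / R * ρ))
      (cr (a₀ t) (b₀ t)) (a₀ t)
    congr 1
    rw [smul_sub, smul_smul, smul_smul, sub_eq_add_neg, ← neg_smul, this, smul_sub, smul_smul,
      smul_smul, neg_smul, sub_eq_add_neg]

theorem exists_hasMFDerivAt_smulRight {γ : ℝ → CotS2} {t : ℝ} {a' b' : E3}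
    (h : MDifferentiableAt 𝓘(ℝ, ℝ) ICot γ t)
    (ha : HasDerivAt (fun t => pos (γ t)) a' t) (hb : HasDerivAt (fun t => mom (γ t)) b' t) :
    ∃ v : TangentSpace ICot (γ t),
      HasMFDerivAt 𝓘(ℝ, ℝ) ICot γ t ((1 : ℝ →L[ℝ] ℝ).smulRight v) ∧
      mvfderiv ICot pos (γ t) v = a' ∧ mvfderiv ICot mom (γ t) v = b' := by
  set D : ℝ →L[ℝ] TangentSpace ICot (γ t) := mfderiv 𝓘(ℝ, ℝ) ICot γ t with hD
  refine ⟨D 1, ?_, ?_, ?_⟩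
  · have e : (1 : ℝ →L[ℝ] ℝ).smulRight (D 1) = D := by
      ext
      exact one_smul ℝ (D 1)
    rw [e]
    exact h.hasMFDerivAt
  · have h1 := mvfderiv_comp' (mdiff_pos (γ t)) h
    have h2 : mvfderiv 𝓘(ℝ, ℝ) (fun t => pos (γ t)) t = _ := ha.hasFDerivAt.hasMFDerivAt.mfderiv
    rw [h2] at h1
    have h3 := DFunLike.congr_fun h1 (1 : ℝ)
    refine h3.symm.trans ?_
    exact one_smul ℝ a'
  · have h1 := mvfderiv_comp' (mdiff_mom (γ t)) h
    have h2 : mvfderiv 𝓘(ℝ, ℝ) (fun t => mom (γ t)) t = _ := hb.hasFDerivAt.hasMFDerivAt.mfderiv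
    rw [h2] at h1
    have h3 := DFunLike.congr_fun h1 (1 : ℝ)
    refine h3.symm.trans ?_
    exact one_smul ℝ b'

/-! ### The Hamiltonian flow of $H_{s,\alpha}$ -/

theorem incl_dphi (q : S2) : incl q (dphi q) = rot q := Classical.choose_spec (exists_dphi q)

theorem snd_dphi (z : CotS2) : z.snd (dphi z.proj) = ⟪mom z, rot (pos z)⟫ := by
  rw [← inner_sharp, incl_dphi]; rfl

/-- The Hamiltonian `H_{s,α}` as a function of position and momentum in Euclidean space. -/
def ambientH (s α : ℝ) (x : E3 × E3) : ℝ :=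
  √(⟪x.2, x.2⟫ + s ^ 2) + α * (⟪x.2, rot x.1⟫ + s * x.1 2)

theorem Rfun_eq (s : ℝ) (z : CotS2) : Rfun s z = √(⟪mom z, mom z⟫ + s ^ 2) := by
  rw [Rfun, dualInner_gbar]; rfl

theorem Hfun_eq (s α : ℝ) : Hfun s α = fun z => ambientH s α (pos z, mom z) := by
  funext z
  rw [Hfun, Rfun_eq, Omegafun, snd_dphi]; rfl

theorem hasFDerivAt_ambientH (s α : ℝ) {x : E3 × E3} (h : 0 < ⟪x.2, x.2⟫ + s ^ 2) :
    ∃ L : E3 × E3 →L[ℝ] ℝ, HasFDerivAt (ambientH s α) L x ∧ ∀ u w, L (u, w) =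
      ⟪x.2, w⟫ / √(⟪x.2, x.2⟫ + s ^ 2) + α * (⟪w, rot x.1⟫ + ⟪x.2, rot u⟫ + s * u 2) := by
  have hf : HasFDerivAt (Prod.fst : E3 × E3 → E3) (ContinuousLinearMap.fst ℝ E3 E3) x := hasFDerivAt_fst
  have hs : HasFDerivAt (Prod.snd : E3 × E3 → E3) (ContinuousLinearMap.snd ℝ E3 E3) x := hasFDerivAt_snd
  have h2 := ((EuclideanSpace.proj (2 : Fin 3) : E3 →L[ℝ] ℝ).hasFDerivAt (x := x.1)).comp x hf
  have h1 := (((hs.inner ℝ hs).add_const (s ^ 2)).sqrt h.ne').add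
    (((hs.inner ℝ (rot.hasFDerivAt.comp x hf)).add (h2.const_mul s)).const_mul α)
  refine ⟨_, h1, fun u w => ?_⟩
  simp [real_inner_comm]
  ring

theorem contDiffAt_ambientH (s α : ℝ) {x : E3 × E3} (h : 0 < ⟪x.2, x.2⟫ + s ^ 2) :
    ContDiffAt ℝ ∞ (ambientH s α) x := by
  have h2 : ContDiff ℝ ∞ (fun x : E3 × E3 => x.1 2) :=
    (EuclideanSpace.proj (2 : Fin 3) : E3 →L[ℝ] ℝ).contDiff.comp contDiff_fst
  have h3 : ContDiff ℝ ∞ (fun x : E3 × E3 => ⟪x.2, rot x.1⟫) :=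
    contDiff_snd.inner ℝ (rot.contDiff.comp contDiff_fst)
  have h4 : ContDiff ℝ ∞ (fun x : E3 × E3 => ⟪x.2, x.2⟫ + s ^ 2) :=
    (contDiff_snd.inner ℝ contDiff_snd).add contDiff_const
  exact (h4.contDiffAt.sqrt h.ne').add
    (contDiff_const.mul (h3.add (contDiff_const.mul h2))).contDiffAt

theorem contMDiff_pos_mom : ContMDiff ICot 𝓘(ℝ, E3 × E3) ∞ fun z => (pos z, mom z) :=
  contMDiff_pos.prodMk_space contMDiff_mom

theorem contMDiffAt_Hfun (s α : ℝ) {z : CotS2} (h : 0 < ⟪mom z, mom z⟫ + s ^ 2) :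
    ContMDiffAt ICot 𝓘(ℝ, ℝ) ∞ (Hfun s α) z := by
  rw [Hfun_eq]
  exact (contDiffAt_ambientH s α (x := (pos z, mom z)) h).contMDiffAt.comp z (contMDiff_pos_mom z)

theorem mvfderiv_Hfun (s α : ℝ) {z : CotS2} (h : 0 < ⟪mom z, mom z⟫ + s ^ 2)
    (ξ : TangentSpace ICot z) : mvfderiv ICot (Hfun s α) z ξ =
      ⟪mom z, mvfderiv ICot mom z ξ⟫ / √(⟪mom z, mom z⟫ + s ^ 2) +
      α * (⟪mvfderiv ICot mom z ξ, rot (pos z)⟫ + ⟪mom z, rot (mvfderiv ICot pos z ξ)⟫ +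
        s * mvfderiv ICot pos z ξ 2) := by
  obtain ⟨L, hL, hL'⟩ := hasFDerivAt_ambientH s α (x := (pos z, mom z)) h
  rw [Hfun_eq, mvfderiv_comp_hasFDerivAt (f := fun z => (pos z, mom z)) hL
    ((mdiff_pos z).prodMk_space (mdiff_mom z)), mvfderiv_prodMk (mdiff_pos z) (mdiff_mom z), hL']

theorem detForm_apply (x y z : E3) : detForm ![x, y, z] = ⟪x, cr y z⟫ := by
  change (EuclideanSpace.basisFun (Fin 3) ℝ).toBasis.det ![x, y, z] = _
  rw [Module.Basis.det_apply, Matrix.det_fin_three, inner_eq]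
  simp [Module.Basis.toMatrix_apply]
  ring

theorem mubar_apply (q : S2) (v w : TS q) : mubar q ![v, w] = ⟪(q : E3), cr (incl q v) (incl q w)⟫ := by
  rw [← detForm_apply]
  change detForm _ = _
  congr 1
  ext i; fin_cases i <;> rfl

/-- Hamilton's equation at a point, with $u=dq(\xi)$ and $w=dP(\xi)$. The multiple of $q$ in the
velocity of $P$ drops out because $u$ is tangent, and the term $\alpha s\,u_3$ comes from the area
form evaluated on the rotation field. -/
theorem hamiltonian_identity {q u : E3} (hq : ⟪q, q⟫ = 1) (hu : ⟪q, u⟫ = 0) (P w : E3)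
    (R s α ρ : ℝ) :
    ⟪(1 / R) • (s • cr q P - ρ • q) + α • rot P, u⟫ - ⟪w, (1 / R) • P + α • rot q⟫ -
      s * ⟪q, cr ((1 / R) • P + α • rot q) u⟫ =
      -(⟪P, w⟫ / R + α * (⟪w, rot q⟫ + ⟪P, rot u⟫ + s * u 2)) := by
  simp only [inner_eq] at *
  simp only [PiLp.add_apply, PiLp.sub_apply, PiLp.smul_apply, smul_eq_mul, cr_zero, cr_one, cr_two,
    rot_zero, rot_one, rot_two]
  linear_combination (-ρ / R + α * s * q 2) * hu - α * s * u 2 * hq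

theorem isHamiltonianVector_Hfun (s α : ℝ) {z : CotS2} (h : 0 < ⟪mom z, mom z⟫ + s ^ 2)
    {v : TangentSpace ICot z}
    (h₁ : mvfderiv ICot pos z v =
      (1 / √(⟪mom z, mom z⟫ + s ^ 2)) • mom z + α • rot (pos z))
    (h₂ : mvfderiv ICot mom z v = (1 / √(⟪mom z, mom z⟫ + s ^ 2)) •
      (s • cr (pos z) (mom z) - ⟪mom z, mom z⟫ • pos z) + α • rot (mom z)) :
    IsHamiltonianVector ICot (twisted (s • mubar)) (Hfun s α) z v := by
  intro ξ
  have h3 : (s • mubar) z.proj ![mfderiv ICot (𝓡 2) (Bundle.TotalSpace.proj : CotS2 → S2) z v,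
      mfderiv ICot (𝓡 2) (Bundle.TotalSpace.proj : CotS2 → S2) z ξ] =
      s * ⟪pos z, cr (mvfderiv ICot pos z v) (mvfderiv ICot pos z ξ)⟫ := by
    rw [mvfderiv_pos]
    exact congrArg (s * ·) (mubar_apply _ _ _)
  rw [twisted_apply, h3, mvfderiv_Hfun s α h, h₁, h₂]
  exact hamiltonian_identity (inner_pos_pos z) (inner_pos_dpos z ξ) _ _ _ _ _ _

/-- Through every point with `R_s > 0` there passes a complete integral curve of `H_{s,α}`, along
which `H_{s,α}` is constant. -/
theorem exists_integralCurve_Hfun (s α : ℝ) {z : CotS2} (h : 0 < ⟪mom z, mom z⟫ + s ^ 2) :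
    ∃ γ : ℝ → CotS2, γ 0 = z ∧ ∀ t, Hfun s α (γ t) = Hfun s α z ∧
      ∃ v : TangentSpace ICot (γ t),
        IsHamiltonianVector ICot (twisted (s • mubar)) (Hfun s α) (γ t) v ∧
        HasMFDerivAt 𝓘(ℝ, ℝ) ICot γ t ((1 : ℝ →L[ℝ] ℝ).smulRight v) := by
  obtain ⟨a, b, ha, hb, ha0, hb0, H⟩ := exists_orbit (inner_pos_pos z) (inner_pos_mom z) s α
    (Real.sqrt_pos.2 h) (Real.sq_sqrt h.le)
  have hmem : ∀ t, a t ∈ Metric.sphere (0 : E3) 1 := by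
    intro t
    have := (H t).1
    rw [real_inner_self_eq_norm_sq, pow_eq_one_iff_of_nonneg (norm_nonneg _) two_ne_zero] at this
    simpa using this
  set σ : ℝ → S2 := Set.codRestrict a _ hmem
  have hσ : ContMDiff 𝓘(ℝ, ℝ) (𝓡 2) ∞ σ := ha.contMDiff.codRestrict_sphere (n := 2) hmem
  set γ : ℝ → CotS2 := fun t => ⟨σ t, flat (σ t) (b t)⟩
  have hγ : ContMDiff 𝓘(ℝ, ℝ) ICot ∞ γ := fun t =>
    contMDiffAt_mk_flat (hσ t) hb.contMDiff.contMDiffAt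
  have hpos : ∀ t, pos (γ t) = a t := fun _ => rfl
  have hmom : ∀ t, mom (γ t) = b t := fun t => sharp_flat (σ t) (H t).2.1
  refine ⟨γ, ?_, fun t => ?_⟩
  · ext1
    · exact Subtype.ext ha0
    · have h0 : σ 0 = z.proj := Subtype.ext ha0
      have hflat : flat z.proj (mom z) = z.snd := flat_sharp _ _
      change flat (σ 0) (b 0) ≍ z.snd
      rw [h0, hb0, hflat]
  · obtain ⟨-, -, h3, h4, h5, h6⟩ := H t
    refine ⟨?_, ?_⟩
    · simp only [Hfun_eq, ambientH, hpos, hmom, h3, h4]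
    · obtain ⟨v, hv, hv1, hv2⟩ := exists_hasMFDerivAt_smulRight (a' := _) (b' := _)
        (hγ.mdifferentiableAt (by simp) (x := t)) h5
        (by simpa only [hmom] using h6)
      refine ⟨v, isHamiltonianVector_Hfun s α ?_ ?_ ?_, hv⟩
      · rw [hmom, h3]; exact h
      · rw [hv1, hmom, h3, hpos]
      · rw [hv2, hmom, h3, hpos]

/-- $R_s$ vanishes only for $s=0$ and $P=0$, where $H_{s,\alpha}=0$ while $c=\sqrt{2k}>0$. So the
level avoids the singularity of the square root. -/
theorem inner_mom_add_pos {s α k : ℝ} (hs : 0 ≤ s) (hk : 0 < k) {z : CotS2}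
    (hz : Hfun s α z = cval s α k) : 0 < ⟪mom z, mom z⟫ + s ^ 2 := by
  have h1 : 0 ≤ ⟪mom z, mom z⟫ := real_inner_self_nonneg
  refine lt_of_le_of_ne (by positivity) fun h => ?_
  have h2 : ⟪mom z, mom z⟫ = 0 := by nlinarith [sq_nonneg s]
  have h3 : s = 0 := by nlinarith
  have h4 : mom z = 0 := inner_self_eq_zero.1 h2
  rw [Hfun_eq] at hz
  simp only [ambientH, h3, h4, cval] at hz
  simp at hz
  exact (Real.sqrt_pos.2 hk).ne' hz

/-- The velocity at time $0$ already supplies a Hamiltonian vector at each point of $N$, and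
nondegeneracy makes it unique. -/
theorem isHamiltonianFlowOn_of_exists {E : Type*} [NormedAddCommGroup E] [NormedSpace ℝ E]
    {H : Type*} [TopologicalSpace H] {I : ModelWithCorners ℝ E H}
    {M : Type*} [TopologicalSpace M] [ChartedSpace H M] {w : Form I M 2} {h : M → ℝ} {N : Set M}
    {Φ : ℝ → M → M} (hsmooth : ∀ z ∈ N, ContMDiffAt I 𝓘(ℝ, ℝ) ∞ h z)
    (hw : ∀ z ∈ N, ∀ ξ : TangentSpace I z, (∀ η, w z ![ξ, η] = 0) → ξ = 0)
    (hΦ : ∀ z ∈ N, Φ 0 z = z ∧ ∀ t, Φ t z ∈ N ∧ ∃ v : TangentSpace I (Φ t z),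
      IsHamiltonianVector I w h (Φ t z) v ∧
      HasMFDerivAt 𝓘(ℝ, ℝ) I (fun τ : ℝ => Φ τ z) t ((1 : ℝ →L[ℝ] ℝ).smulRight v)) :
    IsHamiltonianFlowOn I w h N Φ where
  smooth := hsmooth
  existsUnique_vector z hz := by
    obtain ⟨v, hv⟩ : ∃ v : TangentSpace I z, IsHamiltonianVector I w h z v := by
      have h0 := ((hΦ z hz).2 0).2
      rw [(hΦ z hz).1] at h0
      exact h0.imp fun _ => And.left
    refine ⟨v, hv, fun v' hv' => ?_⟩
    refine sub_eq_zero.1 (hw z hz _ fun η => ?_)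
    have h1 := (w z).map_update_sub ![0, η] 0 v' v
    have h2 : ∀ x : TangentSpace I z, Function.update ![0, η] 0 x = ![x, η] := by
      intro x; ext i; fin_cases i <;> rfl
    rw [h2, h2, h2, hv η, hv' η, sub_self] at h1
    exact h1
  map_zero z hz := (hΦ z hz).1
  mapsTo z hz t := ((hΦ z hz).2 t).1
  integralCurve z hz t := ((hΦ z hz).2 t).2

theorem exists_flow_Hfun {s α k : ℝ} (hs : 0 ≤ s) (hk : 0 < k) :
    ∃ ψ : ℝ → CotS2 → CotS2, IsHamiltonianFlowOn ICot (twisted (s • mubar)) (Hfun s α)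
      {z | Hfun s α z = cval s α k} ψ := by
  have : ∀ z : CotS2, ∃ γ : ℝ → CotS2, Hfun s α z = cval s α k → γ 0 = z ∧
      ∀ t, Hfun s α (γ t) = Hfun s α z ∧ ∃ v : TangentSpace ICot (γ t),
        IsHamiltonianVector ICot (twisted (s • mubar)) (Hfun s α) (γ t) v ∧
        HasMFDerivAt 𝓘(ℝ, ℝ) ICot γ t ((1 : ℝ →L[ℝ] ℝ).smulRight v) := by
    intro z
    by_cases hz : Hfun s α z = cval s α k
    · obtain ⟨γ, hγ⟩ := exists_integralCurve_Hfun s α (inner_mom_add_pos hs hk hz)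
      exact ⟨γ, fun _ => hγ⟩
    -- Off the level the value of the flow is irrelevant.
    · exact ⟨fun _ => z, fun h => absurd h hz⟩
  choose γ hγ using this
  refine ⟨fun t z => γ z t, isHamiltonianFlowOn_of_exists
    (fun z hz => contMDiffAt_Hfun s α (inner_mom_add_pos hs hk hz))
    (fun z _ => twisted_nondegenerate _ z) fun z hz => ⟨(hγ z hz).1, fun t => ⟨?_, ?_⟩⟩⟩
  · exact ((hγ z hz).2 t).1.trans hz
  · exact ((hγ z hz).2 t).2

/-! ### The coefficients as functions of the height -/

section Scalars

variable (s α k : ℝ)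

/-- The function `1 - α² |∂_φ|²` in terms of the height. -/
def denomOf (α h : ℝ) : ℝ := 1 - α ^ 2 + α ^ 2 * h ^ 2

/-- The function `r_{s,α,k}` in terms of the height. -/
def radiusOf (h : ℝ) : ℝ := (cval s α k - α * s * h) / denomOf α h

/-- The function `(1 - α² |∂_φ|²) r² - s²` in terms of the height. -/
def weightOf (h : ℝ) : ℝ := denomOf α h * radiusOf s α k h ^ 2 - s ^ 2

variable {s α k}

theorem denomOf_pos (hα₀ : 0 ≤ α) (hα₁ : α < 1) (h : ℝ) : 0 < denomOf α h := by
  unfold denomOf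
  nlinarith [mul_nonneg (sq_nonneg α) (sq_nonneg h)]

theorem lt_cval_sub (hs : 0 ≤ s) (hα₀ : 0 ≤ α) (hk : 0 < k) {h : ℝ} (hh : h ≤ 1) :
    s < cval s α k - α * s * h := by
  have h1 : s < √(2 * k + s ^ 2) := Real.lt_sqrt_of_sq_lt (by linarith)
  unfold cval
  nlinarith [mul_nonneg (mul_nonneg hα₀ hs) (sub_nonneg.2 hh)]

theorem radiusOf_pos (hs : 0 ≤ s) (hα₀ : 0 ≤ α) (hα₁ : α < 1) (hk : 0 < k) {h : ℝ} (hh : h ≤ 1) :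
    0 < radiusOf s α k h :=
  div_pos (hs.trans_lt (lt_cval_sub hs hα₀ hk hh)) (denomOf_pos hα₀ hα₁ h)

/-- With $D=1-\alpha^2|\partial_\varphi|^2$ one has $Dr=c-\alpha sh>s$; since $D\le1$ also $r\ge
Dr>s$, so $Dr^2=(Dr)r>s^2$. -/
theorem weightOf_pos (hs : 0 ≤ s) (hα₀ : 0 ≤ α) (hα₁ : α < 1) (hk : 0 < k) {h : ℝ}
    (hh : h ^ 2 ≤ 1) : 0 < weightOf s α k h := by
  have h1 := lt_cval_sub hs hα₀ hk (h := h) (by nlinarith)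
  have h2 := denomOf_pos hα₀ hα₁ h
  have h3 : denomOf α h ≤ 1 := by unfold denomOf; nlinarith [sq_nonneg α]
  have h4 : denomOf α h * radiusOf s α k h = cval s α k - α * s * h := by
    unfold radiusOf; field_simp
  have h5 := radiusOf_pos hs hα₀ hα₁ hk (h := h) (by nlinarith)
  have h6 : cval s α k - α * s * h ≤ radiusOf s α k h := by
    rw [← h4]; exact mul_le_of_le_one_left h5.le h3
  have h7 : weightOf s α k h =
      (cval s α k - α * s * h) * radiusOf s α k h - s ^ 2 := by
    rw [← h4]; unfold weightOf; ring
  rw [h7]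
  nlinarith

theorem contDiff_denomOf : ContDiff ℝ ∞ (denomOf α) := by unfold denomOf; fun_prop

theorem contDiff_radiusOf (hα₀ : 0 ≤ α) (hα₁ : α < 1) : ContDiff ℝ ∞ (radiusOf s α k) := by
  unfold radiusOf
  exact ContDiff.div (by fun_prop) contDiff_denomOf fun h => (denomOf_pos hα₀ hα₁ h).ne'

theorem contDiff_weightOf (hα₀ : 0 ≤ α) (hα₁ : α < 1) : ContDiff ℝ ∞ (weightOf s α k) :=
  (contDiff_denomOf.mul ((contDiff_radiusOf hα₀ hα₁).pow 2)).sub contDiff_const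

end Scalars

theorem coe_sq (q : S2) : (q : E3) 0 ^ 2 + (q : E3) 1 ^ 2 + (q : E3) 2 ^ 2 = 1 := by
  have h : inner ℝ (q : E3) (q : E3) = 1 := by rw [real_inner_self_eq_norm_sq]; simp
  rw [inner_eq] at h
  linarith

theorem height_sq_le (q : S2) : height q ^ 2 ≤ 1 := by
  unfold height
  nlinarith [coe_sq q, sq_nonneg ((q : E3) 0), sq_nonneg ((q : E3) 1)]

theorem height_le_one (q : S2) : height q ≤ 1 := by nlinarith [height_sq_le q]

theorem dphiSq_eq (q : S2) : dphiSq q = 1 - height q ^ 2 := by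
  rw [dphiSq, gbar_apply, incl_dphi, inner_eq]
  simp [height]
  linarith [coe_sq q]

theorem one_sub_dphiSq (α : ℝ) (q : S2) : 1 - α ^ 2 * dphiSq q = denomOf α (height q) := by
  rw [dphiSq_eq, denomOf]; ring

theorem rfun_eq (s α k : ℝ) (q : S2) : rfun s α k q = radiusOf s α k (height q) := by
  rw [rfun, one_sub_dphiSq, radiusOf]

theorem contMDiff_height : ContMDiff (𝓡 2) 𝓘(ℝ, ℝ) ∞ height :=
  (EuclideanSpace.proj (2 : Fin 3) : E3 →L[ℝ] ℝ).contDiff.contMDiff.comp contMDiff_coe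

theorem beta_eq (q : S2) : beta q = flat q (rot q) := by
  ext v
  rw [beta, gbar_apply, incl_dphi, flat_apply]

theorem inner_coe_rot (q : S2) : inner ℝ (q : E3) (rot q) = 0 := by
  rw [inner_eq]; simp; ring

/-! ### The metric $g_{s,\alpha,k}$ -/

section Metric

variable {s α k : ℝ}

/-- The Euclidean metric. -/
def euclid : E3 →L[ℝ] E3 →L[ℝ] ℝ := innerSL ℝ

/-- The metric `g_{s,α,k}`, as a field of bilinear forms on Euclidean space. -/
def ambientMetric (s α k : ℝ) (x : E3) : E3 →L[ℝ] E3 →L[ℝ] ℝ :=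
  (weightOf s α k (x 2) / (2 * k)) •
    (euclid + (α ^ 2 / denomOf α (x 2)) • (innerSL ℝ (rot x)).smulRight (innerSL ℝ (rot x)))

theorem contDiff_smul_add_smul {X V : Type*} [NormedAddCommGroup X] [NormedSpace ℝ X]
    [NormedAddCommGroup V] [NormedSpace ℝ V] {f g : X → ℝ} {A : X → V} (B : V)
    (hf : ContDiff ℝ ∞ f) (hg : ContDiff ℝ ∞ g) (hA : ContDiff ℝ ∞ A) :
    ContDiff ℝ ∞ fun x => f x • (B + g x • A x) :=
  hf.smul (contDiff_const.add (hg.smul hA))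

theorem contDiff_ambientMetric (hα₀ : 0 ≤ α) (hα₁ : α < 1) :
    ContDiff ℝ ∞ (ambientMetric s α k) := by
  have h2 : ContDiff ℝ ∞ (fun x : E3 => x 2) :=
    (EuclideanSpace.proj (2 : Fin 3) : E3 →L[ℝ] ℝ).contDiff
  have h3 : ContDiff ℝ ∞ (fun x : E3 => innerSL ℝ (rot x)) :=
    (innerSL ℝ (E := E3)).contDiff.comp rot.contDiff
  have h4 : ContDiff ℝ ∞ (fun x : E3 => (innerSL ℝ (rot x)).smulRight (innerSL ℝ (rot x))) :=
    h3.smulRight h3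
  have h5 : ContDiff ℝ ∞ (fun x : E3 => weightOf s α k (x 2) / (2 * k)) :=
    ((contDiff_weightOf hα₀ hα₁).comp h2).div_const _
  have h6 : ContDiff ℝ ∞ (fun x : E3 => α ^ 2 / denomOf α (x 2)) :=
    contDiff_const.div (contDiff_denomOf.comp h2) fun x => (denomOf_pos hα₀ hα₁ _).ne'
  exact contDiff_smul_add_smul _ h5 h6 h4

/-- The bilinear form `g_{s,α,k}` on the tangent space at `q`. -/
def katokForm (s α k : ℝ) (q : S2) : TS q →L[ℝ] TS q →L[ℝ] ℝ :=
  (incl q).precomp ℝ ∘L ambientMetric s α k q ∘L incl q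

theorem katokForm_apply (s α k : ℝ) (q : S2) (v w : TS q) : katokForm s α k q v w =
    weightOf s α k (height q) / (2 * k) * (⟪incl q v, incl q w⟫ +
      α ^ 2 / denomOf α (height q) * (⟪rot q, incl q v⟫ * ⟪rot q, incl q w⟫)) := rfl

theorem le_katokForm (hs : 0 ≤ s) (hα₀ : 0 ≤ α) (hα₁ : α < 1) (hk : 0 < k) (q : S2) (v : TS q) :
    weightOf s α k (height q) / (2 * k) * ‖incl q v‖ ^ 2 ≤ katokForm s α k q v v := by
  have h1 := weightOf_pos hs hα₀ hα₁ hk (height_sq_le q)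
  have h2 := denomOf_pos hα₀ hα₁ (height q)
  rw [katokForm_apply, real_inner_self_eq_norm_sq]
  refine mul_le_mul_of_nonneg_left (le_add_of_nonneg_right ?_) (by positivity)
  exact mul_nonneg (by positivity) (mul_self_nonneg _)

theorem katokForm_pos (hs : 0 ≤ s) (hα₀ : 0 ≤ α) (hα₁ : α < 1) (hk : 0 < k) (q : S2) (v : TS q)
    (hv : v ≠ 0) : 0 < katokForm s α k q v v := by
  have h1 := weightOf_pos hs hα₀ hα₁ hk (height_sq_le q)
  have h2 : 0 < ‖incl q v‖ := norm_pos_iff.2 fun h => hv (incl_injective q (by simpa using h))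
  exact lt_of_lt_of_le (by positivity) (le_katokForm hs hα₀ hα₁ hk q v)

theorem isVonNBounded_katokForm (hs : 0 ≤ s) (hα₀ : 0 ≤ α) (hα₁ : α < 1) (hk : 0 < k) (q : S2) :
    Bornology.IsVonNBounded ℝ {v : TS q | katokForm s α k q v v < 1} := by
  let A : EuclideanSpace ℝ (Fin 2) →L[ℝ] E3 := incl q
  change Bornology.IsVonNBounded ℝ {v : EuclideanSpace ℝ (Fin 2) | katokForm s α k q v v < 1}
  rw [NormedSpace.isVonNBounded_iff]
  have hA : LinearMap.ker A.toLinearMap = ⊥ := LinearMap.ker_eq_bot.2 (incl_injective q)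
  obtain ⟨K, -, hK⟩ := A.toLinearMap.exists_antilipschitzWith hA
  have h1 := weightOf_pos hs hα₀ hα₁ hk (height_sq_le q)
  set c := weightOf s α k (height q) / (2 * k)
  have hc : 0 < c := by positivity
  -- A crude radius: it exceeds $1$, so a vector with $\|Av\|\ge1/c+1$ has $\|Av\|^2\ge\|Av\|$ and
  -- hence $c\|Av\|^2>1$.
  refine (hK.isBounded_preimage (Metric.isBounded_ball (x := (0 : E3)) (r := 1 / c + 1))).subset ?_
  intro v hv
  have h2 : c * ‖A v‖ ^ 2 < 1 := (le_katokForm hs hα₀ hα₁ hk q v).trans_lt hv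
  rw [Set.mem_preimage, mem_ball_zero_iff]
  change ‖A v‖ < _
  by_contra! h
  have h3 : 1 < ‖A v‖ := lt_of_lt_of_le (by linarith [one_div_pos.2 hc]) h
  have h4 : ‖A v‖ ≤ ‖A v‖ ^ 2 := by nlinarith
  have h5 : c * (1 / c + 1) ≤ c * ‖A v‖ ^ 2 := mul_le_mul_of_nonneg_left (h.trans h4) hc.le
  rw [mul_add, mul_one_div_cancel hc.ne'] at h5
  linarith

/-- The Riemannian metric `g_{s,α,k}`. -/
def katokMetric (hs : 0 ≤ s) (hα₀ : 0 ≤ α) (hα₁ : α < 1) (hk : 0 < k) :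
    Bundle.ContMDiffRiemannianMetric (𝓡 2) ∞ (EuclideanSpace ℝ (Fin 2)) TS where
  inner := katokForm s α k
  symm q v w := by
    rw [katokForm_apply, katokForm_apply, real_inner_comm, mul_comm ⟪rot q, incl q v⟫]
  pos := katokForm_pos hs hα₀ hα₁ hk
  isVonNBounded := isVonNBounded_katokForm hs hα₀ hα₁ hk
  contMDiff := contMDiff_pullback_incl
    ((contDiff_ambientMetric hα₀ hα₁).contMDiff.comp contMDiff_coe)

/-- The Sherman-Morrison formula: $\bar
g+\frac{\alpha^2}{1-\alpha^2|\partial_\varphi|^2}\beta\otimes\beta$ is a rank-one change of $\bar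
g$, and its dual is $\bar g-\alpha^2\partial_\varphi\otimes\partial_\varphi$ on covectors. -/
theorem katokForm_inverse (hs : 0 ≤ s) (hα₀ : 0 ≤ α) (hα₁ : α < 1) (hk : 0 < k) (q : S2)
    (p : CoT q) : (katokForm s α k q).inverse p = (2 * k / weightOf s α k (height q)) •
      ((gbar q).inverse p - (α ^ 2 * p (dphi q)) • dphi q) := by
  have h1 := weightOf_pos hs hα₀ hα₁ hk (height_sq_le q)
  have h2 := denomOf_pos hα₀ hα₁ (height q)
  have hinv := isInvertible_of_pos _ (katokForm_pos hs hα₀ hα₁ hk q)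
  obtain ⟨e, he⟩ := hinv
  rw [← he, ContinuousLinearMap.inverse_equiv, ContinuousLinearEquiv.coe_coe,
    ContinuousLinearEquiv.symm_apply_eq]
  change p = (e : TS q →L[ℝ] CoT q) _
  rw [he]
  ext w
  rw [katokForm_apply, map_smul, map_sub, map_smul, incl_dphi]
  have hp : ⟪incl q ((gbar q).inverse p), incl q w⟫ = p w := inner_sharp q p w
  have hr : ⟪rot q, incl q ((gbar q).inverse p)⟫ = p (dphi q) := by
    rw [← inner_sharp q p (dphi q), incl_dphi, real_inner_comm]; rfl
  have hD : ⟪rot q, rot (q : E3)⟫ = dphiSq q := by rw [dphiSq, gbar_apply, incl_dphi]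
  have hu := one_sub_dphiSq α q
  simp only [inner_smul_left, inner_sub_left, inner_smul_right, inner_sub_right, hp, hr, hD,
    conj_trivial]
  rw [← hu] at h2 ⊢
  field_simp
  ring

theorem dualInner_katokForm (hs : 0 ≤ s) (hα₀ : 0 ≤ α) (hα₁ : α < 1) (hk : 0 < k) (q : S2)
    (p₁ p₂ : CoT q) : dualInner (katokForm s α k q) p₁ p₂ = gDualFormula s α k q p₁ p₂ := by
  rw [dualInner, katokForm_inverse hs hα₀ hα₁ hk, map_smul, map_sub, map_smul, gDualFormula,
    one_sub_dphiSq, rfun_eq, dualInner, weightOf]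
  simp only [smul_eq_mul]
  ring

theorem kinetic_eq (hs : 0 ≤ s) (hα₀ : 0 ≤ α) (hα₁ : α < 1) (hk : 0 < k) (z : CotS2) :
    kinetic (katokMetric hs hα₀ hα₁ hk) z = k / weightOf s α k (height z.proj) *
      (⟪mom z, mom z⟫ - α ^ 2 * ⟪mom z, rot (pos z)⟫ ^ 2) := by
  rw [kinetic]
  change dualInner (katokForm s α k z.proj) _ _ / 2 = _
  rw [dualInner_katokForm hs hα₀ hα₁ hk, gDualFormula, one_sub_dphiSq, rfun_eq, snd_dphi,
    dualInner_gbar, weightOf]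
  change _ * (⟪mom z, mom z⟫ - _) / 2 = _
  ring

end Metric

/-! ### The fibre translation and its effect on the twisted forms -/

/-- The fibre translation by the covector field dual to the vector field `Y`. -/
def translate (Y : S2 → E3) (z : CotS2) : CotS2 := ⟨z.proj, z.snd + flat z.proj (Y z.proj)⟩

theorem flat_add (q : S2) (x y : E3) : flat q (x + y) = flat q x + flat q y := by
  ext v; simp [inner_add_left]

theorem flat_neg (q : S2) (x : E3) : flat q (-x) = -flat q x := by
  ext v; simp

theorem contMDiff_translate {Y : S2 → E3} (hY : ContMDiff (𝓡 2) 𝓘(ℝ, E3) ∞ Y) :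
    ContMDiff ICot ICot ∞ (translate Y) := by
  have h : translate Y = fun z => ⟨z.proj, flat z.proj (mom z + Y z.proj)⟩ := by
    funext z
    rw [flat_add, mom, flat_sharp]; rfl
  rw [h]
  exact fun z => contMDiffAt_mk_flat (contMDiff_proj z)
    ((contMDiff_mom z).add ((hY.comp contMDiff_proj) z))

theorem translate_translate {Y Z : S2 → E3} (h : ∀ q, Y q + Z q = 0) (z : CotS2) :
    translate Z (translate Y z) = z := by
  ext1
  · rfl
  · refine heq_of_eq ?_
    change z.snd + flat z.proj (Y z.proj) + flat z.proj (Z z.proj) = z.snd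
    rw [add_assoc, ← flat_add, h]
    ext v; simp

theorem contMDiff_neg_field {Y : S2 → E3} (hY : ContMDiff (𝓡 2) 𝓘(ℝ, E3) ∞ Y) :
    ContMDiff (𝓡 2) 𝓘(ℝ, E3) ∞ fun q => -Y q :=
  (contDiff_neg (𝕜 := ℝ) (F := E3)).contMDiff.comp hY

/-- The fibre translation by a smooth covector field is a diffeomorphism. -/
def translateDiffeo (Y : S2 → E3) (hY : ContMDiff (𝓡 2) 𝓘(ℝ, E3) ∞ Y) :
    CotS2 ≃ₘ^∞⟮ICot, ICot⟯ CotS2 where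
  toFun := translate Y
  invFun := translate fun q => -Y q
  left_inv := translate_translate fun q => add_neg_cancel _
  right_inv := translate_translate fun q => neg_add_cancel _
  contMDiff_toFun := contMDiff_translate hY
  contMDiff_invFun := by
    have h := contMDiff_translate (Y := fun q => -Y q) (contMDiff_neg_field hY)
    exact h

theorem pos_translate (Y : S2 → E3) (z : CotS2) : pos (translate Y z) = pos z := rfl

theorem mom_translate {Y : S2 → E3} (hY : ∀ q : S2, ⟪(q : E3), Y q⟫ = 0) (z : CotS2) :
    mom (translate Y z) = mom z + Y z.proj := by
  refine eq_of_flat_eq z.proj (inner_coe_sharp _ _) ?_ ?_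
  · change inner ℝ (pos z) _ = 0
    rw [inner_add_right, inner_pos_mom, zero_add]; exact hY _
  · rw [flat_add]
    exact (flat_sharp z.proj (z.snd + flat z.proj (Y z.proj))).trans
      (congrArg (· + flat z.proj (Y z.proj)) (flat_sharp z.proj z.snd).symm)

/-- The vector field dual to the one-form `η`. -/
def etaField (s α k : ℝ) (q : S2) : E3 := (α * radiusOf s α k (height q)) • rot (q : E3)

theorem etaForm_eq (s α k : ℝ) (q : S2) : etaForm s α k q = flat q (etaField s α k q) := by
  rw [etaForm, rfun_eq, beta_eq]
  ext v
  simp [etaField, inner_smul_left]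

theorem inner_coe_etaField (s α k : ℝ) (q : S2) : ⟪(q : E3), etaField s α k q⟫ = 0 := by
  rw [etaField, inner_smul_right, inner_coe_rot, mul_zero]

theorem contMDiff_etaField {s α k : ℝ} (hα₀ : 0 ≤ α) (hα₁ : α < 1) :
    ContMDiff (𝓡 2) 𝓘(ℝ, E3) ∞ (etaField s α k) :=
  (contMDiff_const.mul ((contDiff_radiusOf hα₀ hα₁).contMDiff.comp contMDiff_height)).smul
    (rot.contDiff.contMDiff.comp contMDiff_coe)

theorem twisted_smul_mubar_apply (s : ℝ) (z : CotS2) (ξ η : TangentSpace ICot z) :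
    twisted (s • mubar) z ![ξ, η] =
      ⟪mvfderiv ICot mom z ξ, mvfderiv ICot pos z η⟫ -
        ⟪mvfderiv ICot mom z η, mvfderiv ICot pos z ξ⟫ -
      s * ⟪pos z, cr (mvfderiv ICot pos z ξ) (mvfderiv ICot pos z η)⟫ := by
  rw [twisted_apply]
  congr 1
  rw [mvfderiv_pos]
  exact congrArg (s * ·) (mubar_apply _ _ _)

/-- On the sphere $\eta=\langle Y,dq\rangle$ with $Y$ its dual field, so $d\eta$ has the same shape
as $d\lambda$ and the two can be added. -/
theorem extD_etaForm {s α k : ℝ} (hα₀ : 0 ≤ α) (hα₁ : α < 1) (z : CotS2)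
    (ξ η : TangentSpace ICot z) :
    extD (𝓡 2) (oneForm (𝓡 2) (etaForm s α k)) z.proj
      ![mfderiv ICot (𝓡 2) (Bundle.TotalSpace.proj : CotS2 → S2) z ξ,
        mfderiv ICot (𝓡 2) (Bundle.TotalSpace.proj : CotS2 → S2) z η] =
      ⟪mvfderiv ICot (fun z => etaField s α k z.proj) z ξ, mvfderiv ICot pos z η⟫ -
        ⟪mvfderiv ICot (fun z => etaField s α k z.proj) z η, mvfderiv ICot pos z ξ⟫ := by
  have h1 : etaForm s α k = fun q : S2 => innerSL ℝ (etaField s α k q) ∘L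
      mvfderiv (𝓡 2) (fun x : S2 => (x : E3)) q := funext (etaForm_eq s α k)
  have hE := contMDiff_etaField (s := s) (k := k) hα₀ hα₁
  rw [h1, extD_oneForm_inner contMDiff_coe hE,
    mvfderiv_comp' (hE.mdifferentiableAt (by simp)) (mdiff_proj z), mvfderiv_pos]
  rfl

theorem dpos_translate {Y : S2 → E3} (hY : ContMDiff (𝓡 2) 𝓘(ℝ, E3) ∞ Y) (z : CotS2)
    (ξ : TangentSpace ICot z) :
    mvfderiv ICot pos (translate Y z) (mfderiv ICot ICot (translate Y) z ξ) =
      mvfderiv ICot pos z ξ :=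
  (DFunLike.congr_fun (mvfderiv_comp' (mdiff_pos (translate Y z))
    ((contMDiff_translate hY).mdifferentiableAt (by simp))) ξ).symm

theorem dmom_translate {Y : S2 → E3} (hY : ContMDiff (𝓡 2) 𝓘(ℝ, E3) ∞ Y)
    (hY' : ∀ q : S2, ⟪(q : E3), Y q⟫ = 0) (z : CotS2) (ξ : TangentSpace ICot z) :
    mvfderiv ICot mom (translate Y z) (mfderiv ICot ICot (translate Y) z ξ) =
      mvfderiv ICot mom z ξ + mvfderiv ICot (fun z : CotS2 => Y z.proj) z ξ := by
  have hYz : MDifferentiableAt ICot 𝓘(ℝ, E3) (fun z : CotS2 => Y z.proj) z :=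
    (hY.comp contMDiff_proj).mdifferentiableAt (by simp)
  have h1 := DFunLike.congr_fun (mvfderiv_comp' (mdiff_mom (translate Y z))
    ((contMDiff_translate hY).mdifferentiableAt (by simp))) ξ
  have h2 : (fun z => mom (translate Y z)) = mom + fun z : CotS2 => Y z.proj :=
    funext (mom_translate hY')
  rw [h2, mvfderiv_add (mdiff_mom z) hYz] at h1
  exact h1.symm

theorem translate_identity {a b c d a' b' c' d' q q' u v : E3} (ha : a' = a + u)
    (hb : b' = b + v) (hc : c' = c) (hd : d' = d) (hq : q' = q) (s : ℝ) :
    ⟪a', d'⟫ - ⟪b', c'⟫ - s * ⟪q', cr c' d'⟫ =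
      ⟪a, d⟫ - ⟪b, c⟫ - s * ⟪q, cr c d⟫ + (⟪u, d⟫ - ⟪v, c⟫) := by
  rw [ha, hb, hc, hd, hq, inner_add_left, inner_add_left]
  ring

theorem twisted_smul_mubar_translate (s : ℝ) {Y : S2 → E3}
    (hY : ContMDiff (𝓡 2) 𝓘(ℝ, E3) ∞ Y) (hY' : ∀ q : S2, ⟪(q : E3), Y q⟫ = 0) (z : CotS2)
    (ξ η : TangentSpace ICot z) :
    twisted (s • mubar) (translate Y z)
        ![mfderiv ICot ICot (translate Y) z ξ, mfderiv ICot ICot (translate Y) z η] =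
      twisted (s • mubar) z ![ξ, η] +
        (⟪mvfderiv ICot (fun z : CotS2 => Y z.proj) z ξ, mvfderiv ICot pos z η⟫ -
          ⟪mvfderiv ICot (fun z : CotS2 => Y z.proj) z η, mvfderiv ICot pos z ξ⟫) := by
  have e1 := dmom_translate hY hY' z ξ
  have e2 := dmom_translate hY hY' z η
  have e3 := dpos_translate hY z ξ
  have e4 := dpos_translate hY z η
  have e5 := pos_translate Y z
  rw [twisted_smul_mubar_apply, twisted_smul_mubar_apply]
  exact (translate_identity e1 e2 e3 e4 e5 s)

theorem twisted_magneticForm {s α k : ℝ} (hα₀ : 0 ≤ α) (hα₁ : α < 1) (z : CotS2)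
    (ξ η : TangentSpace ICot z) :
    twisted (magneticForm s α k) z ![ξ, η] = twisted (s • mubar) z ![ξ, η] -
      (⟪mvfderiv ICot (fun z => etaField s α k z.proj) z ξ, mvfderiv ICot pos z η⟫ -
        ⟪mvfderiv ICot (fun z => etaField s α k z.proj) z η, mvfderiv ICot pos z ξ⟫) := by
  rw [← extD_etaForm hα₀ hα₁, twisted_apply, twisted_apply]
  have h : ∀ v, magneticForm s α k z.proj v =
    (s • mubar) z.proj v + extD (𝓡 2) (oneForm (𝓡 2) (etaForm s α k)) z.proj v := fun _ => rfl
  rw [h]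
  ring

/-- The translation replaces $P$ by $P-Y$, which subtracts $\pi^*d\eta$ from $d\lambda$ and leaves
$\pi^*\bar\mu$ unchanged. -/
theorem twisted_translate {s α k : ℝ} (hα₀ : 0 ≤ α) (hα₁ : α < 1) (z : CotS2)
    (ξ η : TangentSpace ICot z) :
    twisted (magneticForm s α k) z ![ξ, η] =
      twisted (s • mubar) (translate (fun q => -etaField s α k q) z)
        ![mfderiv ICot ICot (translate fun q => -etaField s α k q) z ξ,
          mfderiv ICot ICot (translate fun q => -etaField s α k q) z η] := by
  have hE := contMDiff_etaField (s := s) (k := k) hα₀ hα₁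
  have h : mvfderiv ICot (fun z : CotS2 => -etaField s α k z.proj) z =
      -mvfderiv ICot (fun z : CotS2 => etaField s α k z.proj) z := mvfderiv_neg
  rw [twisted_smul_mubar_translate s (contMDiff_neg_field hE)
    (fun q => by rw [inner_neg_right, inner_coe_etaField, neg_zero]), twisted_magneticForm hα₀ hα₁,
    h, neg_apply, neg_apply, inner_neg_left, inner_neg_left]
  ring

/-! ### Comparison of the two energies -/

section

variable {s α k : ℝ}

/-- The function `r - α p(∂_φ)`. -/
def slack (s α k : ℝ) (z : CotS2) : ℝ :=
  radiusOf s α k (height z.proj) - α * ⟪mom z, rot (pos z)⟫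

theorem mom_translate_eta (s α k : ℝ) (z : CotS2) :
    mom (translate (fun q => -etaField s α k q) z) =
      mom z - (α * radiusOf s α k (height z.proj)) • rot (pos z) := by
  rw [mom_translate fun q => by rw [inner_neg_right, inner_coe_etaField, neg_zero]]
  exact (sub_eq_add_neg _ _).symm

theorem inner_rot_pos (z : CotS2) :
    ⟪rot (pos z), rot (pos z)⟫ = 1 - height z.proj ^ 2 := by
  rw [← dphiSq_eq, dphiSq, gbar_apply, incl_dphi]; rfl

theorem denomOf_mul_radiusOf (hα₀ : 0 ≤ α) (hα₁ : α < 1) (h : ℝ) :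
    denomOf α h * radiusOf s α k h = cval s α k - α * s * h := by
  have := denomOf_pos hα₀ hα₁ h
  unfold radiusOf; field_simp

/-- This is what $r$ is made for: $(1-\alpha^2|\partial_\varphi|^2)r=c-\alpha sh$ absorbs the
potential, the constant $c$ and the shift $-\alpha^2r|\partial_\varphi|^2$ of the linear term. -/
theorem Hfun_translate (hα₀ : 0 ≤ α) (hα₁ : α < 1) (z : CotS2) :
    Hfun s α (translate (fun q => -etaField s α k q) z) - cval s α k =
      Rfun s (translate (fun q => -etaField s α k q) z) - slack s α k z := by
  have h := denomOf_mul_radiusOf (s := s) (k := k) hα₀ hα₁ (height z.proj)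
  have h2 := inner_rot_pos z
  rw [Hfun, Omegafun, snd_dphi, mom_translate_eta, pos_translate]
  change _ + α * (_ + s * height z.proj) - _ = _
  rw [inner_sub_left, inner_smul_left, h2, slack]
  unfold denomOf at h
  simp only [conj_trivial]
  linear_combination h

theorem Rfun_sq_sub_slack_sq (z : CotS2) :
    Rfun s (translate (fun q => -etaField s α k q) z) ^ 2 - slack s α k z ^ 2 =
      ⟪mom z, mom z⟫ - α ^ 2 * ⟪mom z, rot (pos z)⟫ ^ 2 - weightOf s α k (height z.proj) := by
  have h2 := inner_rot_pos z
  have h0 : 0 ≤ ⟪mom (translate (fun q => -etaField s α k q) z),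
    mom (translate (fun q => -etaField s α k q) z)⟫ := real_inner_self_nonneg
  rw [Rfun_eq, Real.sq_sqrt (by positivity), mom_translate_eta, slack, weightOf, denomOf]
  simp only [inner_sub_left, inner_sub_right, inner_smul_left, inner_smul_right, conj_trivial, h2,
    real_inner_comm (mom z) (rot (pos z))]
  ring

/-- A difference of two squares, $(R\circ F)^2-\ell^2$, factors, and one factor is
$H_{s,\alpha}\circ F-c$. -/
theorem kinetic_sub (hs : 0 ≤ s) (hα₀ : 0 ≤ α) (hα₁ : α < 1) (hk : 0 < k) (z : CotS2) :
    kinetic (katokMetric hs hα₀ hα₁ hk) z = k + k / weightOf s α k (height z.proj) *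
      (Rfun s (translate (fun q => -etaField s α k q) z) + slack s α k z) *
      (Hfun s α (translate (fun q => -etaField s α k q) z) - cval s α k) := by
  have h1 := weightOf_pos hs hα₀ hα₁ hk (height_sq_le z.proj)
  have h2 := Rfun_sq_sub_slack_sq (s := s) (α := α) (k := k) z
  rw [Hfun_translate hα₀ hα₁, kinetic_eq]
  field_simp
  linear_combination -h2

/-- Write $y=p(\partial_\varphi)$ and $D=1-\alpha^2|\partial_\varphi|^2$. On the level
$|p|^2=Dr^2-s^2+\alpha^2y^2$, and Cauchy-Schwarz $y^2\le|p|^2|\partial_\varphi|^2$ rearranges to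
$Dy^2\le(Dr^2-s^2)|\partial_\varphi|^2\le Dr^2$. -/
theorem abs_inner_mom_rot_le (hs : 0 ≤ s) (hα₀ : 0 ≤ α) (hα₁ : α < 1) (hk : 0 < k) {z : CotS2}
    (hz : kinetic (katokMetric hs hα₀ hα₁ hk) z = k) :
    |⟪mom z, rot (pos z)⟫| ≤ radiusOf s α k (height z.proj) := by
  have h1 := weightOf_pos hs hα₀ hα₁ hk (height_sq_le z.proj)
  have h2 := denomOf_pos hα₀ hα₁ (height z.proj)
  have h3 := radiusOf_pos hs hα₀ hα₁ hk (height_le_one z.proj)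
  have h4 := inner_rot_pos z
  have h5 := real_inner_mul_inner_self_le (mom z) (rot (pos z))
  rw [kinetic_eq, div_mul_eq_mul_div, div_eq_iff h1.ne', mul_right_inj' hk.ne'] at hz
  rw [h4] at h5
  refine abs_le_of_sq_le_sq ?_ h3.le
  set y := ⟪mom z, rot (pos z)⟫
  set h := height z.proj
  set r := radiusOf s α k h
  have hh : h ^ 2 ≤ 1 := height_sq_le _
  have h6 : ⟪mom z, mom z⟫ = denomOf α h * r ^ 2 - s ^ 2 + α ^ 2 * y ^ 2 := by
    rw [weightOf] at hz; linarith
  rw [h6] at h5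
  have h7 : y ^ 2 * denomOf α h ≤ r ^ 2 * denomOf α h := by
    have e1 : y ^ 2 * denomOf α h = y * y - α ^ 2 * y ^ 2 * (1 - h ^ 2) := by unfold denomOf; ring
    have e2 : 0 ≤ s ^ 2 * (1 - h ^ 2) := mul_nonneg (sq_nonneg _) (by linarith)
    have e3 : 0 ≤ denomOf α h * r ^ 2 * h ^ 2 := by positivity
    nlinarith
  exact le_of_mul_le_mul_right h7 h2

theorem slack_bounds (hs : 0 ≤ s) (hα₀ : 0 ≤ α) (hα₁ : α < 1) (hk : 0 < k) {z : CotS2}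
    (hz : kinetic (katokMetric hs hα₀ hα₁ hk) z = k) :
    0 < slack s α k z ∧ slack s α k z ≤ 2 * radiusOf s α k (height z.proj) := by
  have h1 := abs_le.1 (abs_inner_mom_rot_le hs hα₀ hα₁ hk hz)
  have h3 := radiusOf_pos hs hα₀ hα₁ hk (height_le_one z.proj)
  unfold slack
  constructor <;> nlinarith

/-- Only the passage from $H_g=k$ needs the other factor $R\circ F+\ell$ to be nonzero, and that is
where the positivity of $\ell$ is available. -/
theorem kinetic_eq_iff (hs : 0 ≤ s) (hα₀ : 0 ≤ α) (hα₁ : α < 1) (hk : 0 < k) (z : CotS2) :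
    kinetic (katokMetric hs hα₀ hα₁ hk) z = k ↔
      Hfun s α (translate (fun q => -etaField s α k q) z) = cval s α k := by
  constructor
  · intro hz
    have h0 := (slack_bounds hs hα₀ hα₁ hk hz).1
    have h1 := weightOf_pos hs hα₀ hα₁ hk (height_sq_le z.proj)
    have h2 : 0 ≤ Rfun s (translate (fun q => -etaField s α k q) z) := Real.sqrt_nonneg _
    have h3 : 0 < k / weightOf s α k (height z.proj) *
      (Rfun s (translate (fun q => -etaField s α k q) z) + slack s α k z) := by positivity
    rw [kinetic_sub] at hz
    have h4 := (mul_eq_zero.1 (by linarith :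
      k / weightOf s α k (height z.proj) *
      (Rfun s (translate (fun q => -etaField s α k q) z) + slack s α k z) *
      (Hfun s α (translate (fun q => -etaField s α k q) z) - cval s α k) = 0)).resolve_left h3.ne'
    linarith
  · intro hz
    rw [kinetic_sub, hz]
    ring

/-- The velocity of the time change. -/
def speed (s α k : ℝ) (z : CotS2) : ℝ :=
  2 * k * slack s α k z / weightOf s α k (height z.proj)

theorem contMDiff_slack (hα₀ : 0 ≤ α) (hα₁ : α < 1) :
    ContMDiff ICot 𝓘(ℝ, ℝ) ∞ (slack s α k) :=
  ((contDiff_radiusOf hα₀ hα₁).contMDiff.comp (contMDiff_height.comp contMDiff_proj)).sub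
    (contMDiff_const.mul ((contDiff_snd.inner ℝ (rot.contDiff.comp contDiff_fst)).contMDiff.comp
      contMDiff_pos_mom))

theorem contMDiff_weight (hα₀ : 0 ≤ α) (hα₁ : α < 1) :
    ContMDiff ICot 𝓘(ℝ, ℝ) ∞ fun z : CotS2 => weightOf s α k (height z.proj) :=
  (contDiff_weightOf hα₀ hα₁).contMDiff.comp (contMDiff_height.comp contMDiff_proj)

theorem contMDiff_speed (hs : 0 ≤ s) (hα₀ : 0 ≤ α) (hα₁ : α < 1) (hk : 0 < k) :
    ContMDiff ICot 𝓘(ℝ, ℝ) ∞ (speed s α k) :=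
  (contMDiff_const.mul (contMDiff_slack hα₀ hα₁)).div₀ (contMDiff_weight hα₀ hα₁)
    fun z => (weightOf_pos hs hα₀ hα₁ hk (height_sq_le z.proj)).ne'

theorem speed_pos (hs : 0 ≤ s) (hα₀ : 0 ≤ α) (hα₁ : α < 1) (hk : 0 < k) {z : CotS2}
    (hz : kinetic (katokMetric hs hα₀ hα₁ hk) z = k) : 0 < speed s α k z := by
  have h0 := (slack_bounds hs hα₀ hα₁ hk hz).1
  have h1 := weightOf_pos hs hα₀ hα₁ hk (height_sq_le z.proj)
  unfold speed
  positivity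

/-- Since $\ell\le2r$ on the level, the speed is dominated by a continuous function of the base
point alone, and the sphere is compact. -/
theorem exists_speed_le (hs : 0 ≤ s) (hα₀ : 0 ≤ α) (hα₁ : α < 1) (hk : 0 < k) :
    ∃ C, ∀ z : CotS2, kinetic (katokMetric hs hα₀ hα₁ hk) z = k → speed s α k z ≤ C := by
  have hc : Continuous fun q : S2 => 2 * k * (2 * radiusOf s α k (height q)) /
      weightOf s α k (height q) :=
    (continuous_const.mul (continuous_const.mul ((contDiff_radiusOf hα₀ hα₁).continuous.comp
      contMDiff_height.continuous))).div₀
      ((contDiff_weightOf hα₀ hα₁).continuous.comp contMDiff_height.continuous)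
      fun q => (weightOf_pos hs hα₀ hα₁ hk (height_sq_le q)).ne'
  obtain ⟨C, hC⟩ := isCompact_univ.bddAbove_image hc.continuousOn
  refine ⟨C, fun z hz => le_trans ?_ (hC ⟨z.proj, Set.mem_univ _, rfl⟩)⟩
  have h1 := weightOf_pos hs hα₀ hα₁ hk (height_sq_le z.proj)
  have h2 := (slack_bounds hs hα₀ hα₁ hk hz).2
  exact div_le_div_of_nonneg_right (mul_le_mul_of_nonneg_left h2 (by positivity)) h1.le

theorem contMDiff_kinetic (hs : 0 ≤ s) (hα₀ : 0 ≤ α) (hα₁ : α < 1) (hk : 0 < k) :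
    ContMDiff ICot 𝓘(ℝ, ℝ) ∞ (kinetic (katokMetric hs hα₀ hα₁ hk)) := by
  have h : ContMDiff ICot 𝓘(ℝ, ℝ) ∞ fun z : CotS2 => k / weightOf s α k (height z.proj) *
      (⟪mom z, mom z⟫ - α ^ 2 * ⟪mom z, rot (pos z)⟫ ^ 2) := by
    refine (contMDiff_const.div₀ (contMDiff_weight hα₀ hα₁)
      fun z => (weightOf_pos hs hα₀ hα₁ hk (height_sq_le z.proj)).ne').mul ?_
    have h3 : ContDiff ℝ ∞ fun x : E3 × E3 => ⟪x.2, rot x.1⟫ :=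
      contDiff_snd.inner ℝ (rot.contDiff.comp contDiff_fst)
    have h4 : ContDiff ℝ ∞ fun x : E3 × E3 => ⟪x.2, x.2⟫ := contDiff_snd.inner ℝ contDiff_snd
    have h2 : ContDiff ℝ ∞ fun x : E3 × E3 => ⟪x.2, x.2⟫ - α ^ 2 * ⟪x.2, rot x.1⟫ ^ 2 :=
      h4.sub (contDiff_const.mul (h3.pow 2))
    have h5 := h2.contMDiff.comp contMDiff_pos_mom
    exact h5.congr fun z => rfl
  exact h.congr fun z => kinetic_eq hs hα₀ hα₁ hk z

end

/-! ### Time changes and transport of flows -/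

/-- The autonomous equation `τ' = a (τ)` on the line, with `a` positive and bounded, has a solution
which is a bijection of the line. -/
theorem exists_timeChange {a : ℝ → ℝ} (ha : Continuous a) (hpos : ∀ u, 0 < a u) {C : ℝ}
    (hC : ∀ u, a u ≤ C) :
    ∃ τ : ℝ → ℝ, τ 0 = 0 ∧ Function.Bijective τ ∧ ∀ t, HasDerivAt τ (a (τ t)) t := by
  have hCpos : 0 < C := (hpos 0).trans_le (hC 0)
  have hcont : Continuous fun u => (a u)⁻¹ := ha.inv₀ fun u => (hpos u).ne'
  -- Separation of variables: the solution is the inverse function of $T$.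
  set T : ℝ → ℝ := fun u => ∫ v in (0 : ℝ)..u, (a v)⁻¹ with hT
  have hTd : ∀ u, HasDerivAt T (a u)⁻¹ u := fun u => hcont.integral_hasStrictDerivAt 0 u |>.hasDerivAt
  have hT0 : T 0 = 0 := intervalIntegral.integral_same
  have hmono : StrictMono T := strictMono_of_hasDerivAt_pos hTd fun u => inv_pos.2 (hpos u)
  -- The bound on $a$ gives $T'\ge1/C$, so $T$ is unbounded in both directions and the solution
  -- exists for all times.
  have hmono2 : Monotone fun u => T u - C⁻¹ * u := by
    refine monotone_of_hasDerivAt_nonneg (f' := fun u => (a u)⁻¹ - C⁻¹)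
      (fun u => (hTd u).sub (by simpa using (hasDerivAt_id u).const_mul C⁻¹)) fun u => ?_
    exact sub_nonneg.2 (inv_anti₀ (hpos u) (hC u))
  have hTcont : Continuous T := continuous_iff_continuousAt.2 fun u => (hTd u).continuousAt
  have hsurj : Function.Surjective T := by
    refine hTcont.surjective ?_ ?_
    · refine Filter.tendsto_atTop_mono' _ ?_
        (Filter.Tendsto.const_mul_atTop (inv_pos.2 hCpos) Filter.tendsto_id)
      filter_upwards [Filter.eventually_ge_atTop 0] with u hu
      have := hmono2 hu
      simp only [hT0, mul_zero, sub_zero] at this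
      simpa using this
    · refine Filter.tendsto_atBot_mono' _ ?_
        (Filter.Tendsto.const_mul_atBot (inv_pos.2 hCpos) Filter.tendsto_id)
      filter_upwards [Filter.eventually_le_atBot 0] with u hu
      have := hmono2 hu
      simp only [hT0, mul_zero, sub_zero] at this
      simpa using this
  set e : ℝ ≃o ℝ := hmono.orderIsoOfSurjective T hsurj
  have he : ∀ u, T (e.symm u) = u := fun u => e.apply_symm_apply u
  refine ⟨e.symm, ?_, e.symm.bijective, fun t => ?_⟩
  · rw [e.symm_apply_eq]; exact hT0.symm
  · have h := HasDerivAt.of_local_left_inverse (f := T) (g := e.symm)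
      (e.symm.continuous.continuousAt) (hTd (e.symm t)) (inv_ne_zero (hpos _).ne')
      (Filter.Eventually.of_forall he)
    rwa [inv_inv] at h

section

variable {E : Type*} [NormedAddCommGroup E] [NormedSpace ℝ E] {H : Type*} [TopologicalSpace H]
  {I : ModelWithCorners ℝ E H} {M : Type*} [TopologicalSpace M] [ChartedSpace H M]

/-- The velocity of a reparametrised curve. -/
theorem hasMFDerivAt_comp_time {δ : ℝ → M} {τ : ℝ → ℝ} {t c : ℝ} {v : TangentSpace I (δ (τ t))}
    (hd : HasMFDerivAt 𝓘(ℝ, ℝ) I δ (τ t) ((1 : ℝ →L[ℝ] ℝ).smulRight v)) (hτ : HasDerivAt τ c t) :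
    HasMFDerivAt 𝓘(ℝ, ℝ) I (fun t => δ (τ t)) t ((1 : ℝ →L[ℝ] ℝ).smulRight (c • v)) := by
  have h1 := hd.comp t hτ.hasFDerivAt.hasMFDerivAt
  refine h1.congr_mfderiv ?_
  ext
  change ((1 : ℝ) • c) • v = (1 : ℝ) • (c • v)
  rw [one_smul, one_smul]

/-- The velocity of the image of a reparametrised curve under the inverse of a diffeomorphism. -/
theorem exists_velocity_symm_comp (F : M ≃ₘ^∞⟮I, I⟯ M) {P : ∀ x : M, TangentSpace I x → Prop}
    {δ : ℝ → M} {τ : ℝ → ℝ} {t c : ℝ} {v : TangentSpace I (δ (τ t))} (hv : P (δ (τ t)) v)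
    (hd : HasMFDerivAt 𝓘(ℝ, ℝ) I δ (τ t) ((1 : ℝ →L[ℝ] ℝ).smulRight v)) (hτ : HasDerivAt τ c t) :
    ∃ (u : TangentSpace I (F.symm (δ (τ t)))) (v' : TangentSpace I (F (F.symm (δ (τ t))))),
      P (F (F.symm (δ (τ t)))) v' ∧ mfderiv I I F (F.symm (δ (τ t))) u = c • v' ∧
      HasMFDerivAt 𝓘(ℝ, ℝ) I (fun t => F.symm (δ (τ t))) t ((1 : ℝ →L[ℝ] ℝ).smulRight u) := by
  have h1 := hasMFDerivAt_comp_time hd hτ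
  have hG : MDifferentiableAt I I F.symm (δ (τ t)) := F.symm.contMDiff.mdifferentiableAt (by simp)
  have h2 := hG.hasMFDerivAt.comp t h1
  have key : ∀ (p : M) (v : TangentSpace I p), P p v → ∃ v' : TangentSpace I (F (F.symm p)),
      P (F (F.symm p)) v' ∧
        mfderiv I I F (F.symm p) (mfderiv I I F.symm p (c • v)) = c • v' := by
    intro p v hv
    have hF : MDifferentiableAt I I F (F.symm p) := F.contMDiff.mdifferentiableAt (by simp)
    have hG : MDifferentiableAt I I F.symm p := F.symm.contMDiff.mdifferentiableAt (by simp)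
    have h3 : HasMFDerivAt I I (F ∘ F.symm) p _ := hF.hasMFDerivAt.comp p hG.hasMFDerivAt
    have h4 : (F ∘ F.symm) = id := funext F.apply_symm_apply
    rw [h4] at h3
    have h5 := hasMFDerivAt_unique h3 (hasMFDerivAt_id p)
    -- The points $F(F^{-1}p)$ and $p$ are equal only propositionally, so the vector is transported
    -- along this equality; its underlying vector in the model space stays the same.
    have h6 : ∀ q, q = p → ∃ v' : TangentSpace I q, P q v' ∧ (v' : E) = v := by
      rintro q rfl
      exact ⟨v, hv, rfl⟩
    obtain ⟨v', hv', h7⟩ := h6 _ (F.apply_symm_apply p)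
    refine ⟨v', hv', (DFunLike.congr_fun h5 (c • v)).trans ?_⟩
    exact congrArg (fun x : E => c • x) h7.symm
  obtain ⟨v', hv', h3⟩ := key _ v hv
  refine ⟨mfderiv I I F.symm (δ (τ t)) (c • v), v', hv', h3, h2.congr_mfderiv ?_⟩
  ext
  change mfderiv I I F.symm (δ (τ t)) ((1 : ℝ) • (c • v)) =
    (1 : ℝ) • mfderiv I I F.symm (δ (τ t)) (c • v)
  rw [one_smul, one_smul]

/-- A diffeomorphism which relates, on a set `N`, the Hamiltonian vectors of `h` to a positive
bounded multiple of those of `h'` pulls the flow of `h'` back to the flow of `h`, up to time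
reparametrisation. -/
theorem exists_flow_conjugatesUpToTimeChange (F : M ≃ₘ^∞⟮I, I⟯ M) {w w' : Form I M 2}
    {h h' f : M → ℝ} {N N' : Set M} {ψ : ℝ → M → M} {C : ℝ}
    (hψ : IsHamiltonianFlowOn I w' h' N' ψ) (hF : ∀ z, z ∈ N ↔ F z ∈ N')
    (hh : ∀ z ∈ N, ContMDiffAt I 𝓘(ℝ, ℝ) ∞ h z)
    (hw : ∀ z ∈ N, ∀ ξ : TangentSpace I z, (∀ η, w z ![ξ, η] = 0) → ξ = 0)
    (hf : ContMDiff I 𝓘(ℝ, ℝ) ∞ f) (hf₀ : ∀ z ∈ N, 0 < f z) (hfC : ∀ z ∈ N, f z ≤ C)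
    (hvec : ∀ z ∈ N, ∀ (v : TangentSpace I z) (v' : TangentSpace I (F z)),
      IsHamiltonianVector I w' h' (F z) v' → mfderiv I I F z v = f z • v' →
      IsHamiltonianVector I w h z v) :
    ∃ φ : ℝ → M → M, IsHamiltonianFlowOn I w h N φ ∧ ConjugatesUpToTimeChange I F φ ψ N N' := by
  have hψN : ∀ z ∈ N, ∀ u, F.symm (ψ u (F z)) ∈ N := fun z hz u =>
    (hF _).2 (by rw [F.apply_symm_apply]; exact hψ.mapsTo _ ((hF z).1 hz) u)
  -- The required $\tau'=f(\varphi_t z)$ becomes autonomous once $\varphi_t z$ is replaced by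
  -- $F^{-1}\psi_\tau(Fz)$, which is then taken as the definition of $\varphi$.
  have hτ : ∀ z, ∃ τ : ℝ → ℝ, z ∈ N → τ 0 = 0 ∧ Function.Bijective τ ∧
      ∀ t, HasDerivAt τ (f (F.symm (ψ (τ t) (F z)))) t := by
    intro z
    by_cases hz : z ∈ N
    · have hcont : Continuous fun u => ψ u (F z) := continuous_iff_continuousAt.2 fun u => by
        obtain ⟨v, -, hv⟩ := hψ.integralCurve _ ((hF z).1 hz) u
        exact hv.continuousAt
      obtain ⟨τ, h⟩ := exists_timeChange (a := fun u => f (F.symm (ψ u (F z))))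
        (hf.continuous.comp (F.symm.continuous.comp hcont))
        (fun u => hf₀ _ (hψN z hz u)) (fun u => hfC _ (hψN z hz u))
      exact ⟨τ, fun _ => h⟩
    · exact ⟨id, fun h => absurd h hz⟩
  choose τ hτ using hτ
  refine ⟨fun t z => F.symm (ψ (τ z t) (F z)), isHamiltonianFlowOn_of_exists hh hw
    fun z hz => ⟨?_, fun t => ⟨hψN z hz _, ?_⟩⟩, ?_, f, fun t z => τ z t,
    fun z hz => ⟨hf z, hf₀ z hz⟩,
    fun z hz => ⟨(hτ z hz).1, (hτ z hz).2.1, (hτ z hz).2.2, fun t => F.apply_symm_apply _⟩⟩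
  · rw [(hτ z hz).1, hψ.map_zero _ ((hF z).1 hz), F.symm_apply_apply]
  · obtain ⟨v, hv, hd⟩ := hψ.integralCurve _ ((hF z).1 hz) (τ z t)
    obtain ⟨u, v', hv', hu, hγ⟩ := exists_velocity_symm_comp F
      (P := IsHamiltonianVector I w' h') hv hd ((hτ z hz).2.2 t)
    exact ⟨u, hvec _ (hψN z hz _) u v' hv' hu, hγ⟩
  · ext x
    constructor
    · rintro ⟨z, hz, rfl⟩
      exact (hF z).1 hz
    · intro hx
      exact ⟨F.symm x, (hF _).2 (by rw [F.apply_symm_apply]; exact hx), F.apply_symm_apply x⟩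

end

/-! ### The magnetic flow of $g_{s,\alpha,k}$ -/

section

variable {s α k : ℝ}

/-- The fibre translation `F (q, p) = (q, p - η_q)`. -/
def etaDiffeo (s k : ℝ) (hα₀ : 0 ≤ α) (hα₁ : α < 1) : CotS2 ≃ₘ^∞⟮ICot, ICot⟯ CotS2 :=
  translateDiffeo (fun q => -etaField s α k q)
    (contMDiff_neg_field (contMDiff_etaField hα₀ hα₁))

/-- Apply the product rule to $H_g=k+G\cdot(H_{s,\alpha}\circ F-c)$: on the level the second factor
vanishes, so only $G\,d(H_{s,\alpha}\circ F)$ survives, and there $R\circ F=\ell$ turns $G$ into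
$2k\ell/w$. -/
theorem mvfderiv_kinetic (hs : 0 ≤ s) (hα₀ : 0 ≤ α) (hα₁ : α < 1) (hk : 0 < k) {z : CotS2}
    (hz : kinetic (katokMetric hs hα₀ hα₁ hk) z = k) (ξ : TangentSpace ICot z) :
    mvfderiv ICot (kinetic (katokMetric hs hα₀ hα₁ hk)) z ξ =
      speed s α k z * mvfderiv ICot (Hfun s α) (translate (fun q => -etaField s α k q) z)
        (mfderiv ICot ICot (translate fun q => -etaField s α k q) z ξ) := by
  have hHz := (kinetic_eq_iff hs hα₀ hα₁ hk z).1 hz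
  have hR := inner_mom_add_pos hs hk hHz
  have hT := contMDiff_translate (contMDiff_neg_field (contMDiff_etaField (s := s) (k := k) hα₀ hα₁))
  set T := translate fun q => -etaField s α k q with hTdef
  have hTd : MDifferentiableAt ICot ICot T z := hT.mdifferentiableAt (by simp)
  have hHd : MDifferentiableAt ICot 𝓘(ℝ, ℝ) (Hfun s α) (T z) :=
    (contMDiffAt_Hfun s α hR).mdifferentiableAt (by simp)
  have hHTd : MDifferentiableAt ICot 𝓘(ℝ, ℝ) (fun z => Hfun s α (T z)) z := hHd.comp z hTd
  have hSd : MDifferentiableAt ICot 𝓘(ℝ, ℝ) (fun z => Rfun s (T z)) z := by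
    have h1 : MDifferentiableAt ICot 𝓘(ℝ, ℝ) (Rfun s) (T z) := by
      -- $R_s$ is the Hamiltonian with $\alpha=0$.
      have h2 := contMDiffAt_Hfun s 0 hR
      refine (h2.congr_of_eventuallyEq
        (Filter.Eventually.of_forall fun y => ?_)).mdifferentiableAt (by simp)
      simp [Hfun]
    exact h1.comp z hTd
  have hAd : MDifferentiableAt ICot 𝓘(ℝ, ℝ) (slack s α k) z :=
    (contMDiff_slack hα₀ hα₁).mdifferentiableAt (by simp)
  have hWd : MDifferentiableAt ICot 𝓘(ℝ, ℝ) (fun z : CotS2 => k / weightOf s α k (height z.proj)) z :=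
    (contMDiff_const.div₀ (contMDiff_weight hα₀ hα₁)
      fun z => (weightOf_pos hs hα₀ hα₁ hk (height_sq_le z.proj)).ne').mdifferentiableAt (by simp)
  have hGd : MDifferentiableAt ICot 𝓘(ℝ, ℝ) (fun z : CotS2 => k / weightOf s α k (height z.proj) *
      (Rfun s (T z) + slack s α k z)) z := hWd.mul (hSd.add hAd)
  set G : CotS2 → ℝ := fun z => k / weightOf s α k (height z.proj) *
      (Rfun s (T z) + slack s α k z)
  have hK : kinetic (katokMetric hs hα₀ hα₁ hk) =
      fun z => (fun x : ℝ × ℝ => k + x.1 * (x.2 - cval s α k)) (G z, Hfun s α (T z)) :=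
    funext (kinetic_sub hs hα₀ hα₁ hk)
  have hf1 : HasFDerivAt (Prod.fst : ℝ × ℝ → ℝ) (ContinuousLinearMap.fst ℝ ℝ ℝ)
      (G z, Hfun s α (T z)) := hasFDerivAt_fst
  have hf2 : HasFDerivAt (Prod.snd : ℝ × ℝ → ℝ) (ContinuousLinearMap.snd ℝ ℝ ℝ)
      (G z, Hfun s α (T z)) := hasFDerivAt_snd
  have hg : HasFDerivAt (fun x : ℝ × ℝ => k + x.1 * (x.2 - cval s α k))
      ((G z) • ContinuousLinearMap.snd ℝ ℝ ℝ +
        (Hfun s α (T z) - cval s α k) • ContinuousLinearMap.fst ℝ ℝ ℝ) (G z, Hfun s α (T z)) :=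
    (hf1.mul (hf2.sub_const (cval s α k))).const_add k
  rw [hK, mvfderiv_comp_hasFDerivAt (f := fun z => (G z, Hfun s α (T z))) hg
    (hGd.prodMk_space hHTd), mvfderiv_prodMk hGd hHTd, mvfderiv_comp' hHd hTd]
  have hG : G z = speed s α k z := by
    have h1 := Hfun_translate (s := s) (k := k) hα₀ hα₁ z
    rw [← hTdef, hHz, sub_self] at h1
    simp only [G, speed]
    rw [show Rfun s (T z) = slack s α k z by linarith]
    ring
  simp [hHz, hG]

/-- With $\omega=\omega_{s\bar\mu}$:
$(F^*\omega)(v,\xi)=f\,\omega(v',dF\xi)=-f\,dH_{s,\alpha}(dF\xi)=-dH_g(\xi)$. -/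
theorem isHamiltonianVector_kinetic (hs : 0 ≤ s) (hα₀ : 0 ≤ α) (hα₁ : α < 1) (hk : 0 < k)
    {z : CotS2} (hz : kinetic (katokMetric hs hα₀ hα₁ hk) z = k) {v : TangentSpace ICot z}
    {v' : TangentSpace ICot (translate (fun q => -etaField s α k q) z)}
    (hv' : IsHamiltonianVector ICot (twisted (s • mubar)) (Hfun s α)
      (translate (fun q => -etaField s α k q) z) v')
    (hv : mfderiv ICot ICot (translate fun q => -etaField s α k q) z v = speed s α k z • v') :
    IsHamiltonianVector ICot (twisted (magneticForm s α k))
      (kinetic (katokMetric hs hα₀ hα₁ hk)) z v := by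
  intro ξ
  rw [twisted_translate hα₀ hα₁, hv, mvfderiv_kinetic hs hα₀ hα₁ hk hz]
  set η := mfderiv ICot ICot (translate fun q => -etaField s α k q) z ξ
  have h1 := (twisted (s • mubar) (translate (fun q => -etaField s α k q) z)).map_update_smul
    ![v', η] 0 (speed s α k z) v'
  have h2 : ∀ x, Function.update ![v', η] 0 x = ![x, η] := by
    intro x; ext i; fin_cases i <;> rfl
  rw [h2, h2, hv' η] at h1
  rw [← mul_neg]
  exact h1

theorem exists_katok_flow (hs : 0 ≤ s) (hα₀ : 0 ≤ α) (hα₁ : α < 1) (hk : 0 < k)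
    {ψ : ℝ → CotS2 → CotS2} (hψ : IsHamiltonianFlowOn ICot (twisted (s • mubar)) (Hfun s α)
      {z | Hfun s α z = cval s α k} ψ) :
    ∃ φ : ℝ → CotS2 → CotS2,
      IsHamiltonianFlowOn ICot (twisted (magneticForm s α k))
        (kinetic (katokMetric hs hα₀ hα₁ hk))
        {z | kinetic (katokMetric hs hα₀ hα₁ hk) z = k} φ ∧
      ConjugatesUpToTimeChange ICot (etaDiffeo s k hα₀ hα₁) φ ψ
        {z | kinetic (katokMetric hs hα₀ hα₁ hk) z = k} {z | Hfun s α z = cval s α k} := by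
  obtain ⟨C, hC⟩ := exists_speed_le hs hα₀ hα₁ hk
  exact exists_flow_conjugatesUpToTimeChange (etaDiffeo s k hα₀ hα₁) hψ
    (kinetic_eq_iff hs hα₀ hα₁ hk) (fun z _ => contMDiff_kinetic hs hα₀ hα₁ hk z)
    (fun z _ => twisted_nondegenerate _ z) (contMDiff_speed hs hα₀ hα₁ hk)
    (fun z hz => speed_pos hs hα₀ hα₁ hk hz) hC
    fun z hz v v' hv' hv => isHamiltonianVector_kinetic hs hα₀ hα₁ hk hz hv' hv

end

end MagneticKatok

end

theorem proposition3p5 (s α k : ℝ) (hs : 0 ≤ s) (hα₀ : 0 ≤ α) (hα₁ : α < 1) (hk : 0 < k) :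
    ∃ (g : Bundle.ContMDiffRiemannianMetric (𝓡 2) ∞ (EuclideanSpace ℝ (Fin 2)) MagneticKatok.TS)
      (F : MagneticKatok.CotS2 ≃ₘ^∞⟮MagneticKatok.ICot, MagneticKatok.ICot⟯ MagneticKatok.CotS2)
      (φ ψ : ℝ → MagneticKatok.CotS2 → MagneticKatok.CotS2),
      (∀ (q : MagneticKatok.S2) (p₁ p₂ : MagneticKatok.CoT q),
        MagneticKatok.dualInner (g.inner q) p₁ p₂ = MagneticKatok.gDualFormula s α k q p₁ p₂) ∧
      (∀ z : MagneticKatok.CotS2,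
        F z = ⟨z.proj, z.snd - MagneticKatok.etaForm s α k z.proj⟩) ∧
      MagneticKatok.IsHamiltonianFlowOn MagneticKatok.ICot
        (MagneticKatok.twisted (MagneticKatok.magneticForm s α k)) (MagneticKatok.kinetic g)
        {z | MagneticKatok.kinetic g z = k} φ ∧
      MagneticKatok.IsHamiltonianFlowOn MagneticKatok.ICot
        (MagneticKatok.twisted (s • MagneticKatok.mubar)) (MagneticKatok.Hfun s α)
        {z | MagneticKatok.Hfun s α z = MagneticKatok.cval s α k} ψ ∧
      MagneticKatok.ConjugatesUpToTimeChange MagneticKatok.ICot F φ ψ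
        {z | MagneticKatok.kinetic g z = k}
        {z | MagneticKatok.Hfun s α z = MagneticKatok.cval s α k} := by
  obtain ⟨ψ, hψ⟩ := MagneticKatok.exists_flow_Hfun (α := α) hs hk
  obtain ⟨φ, hφ, hc⟩ := MagneticKatok.exists_katok_flow hs hα₀ hα₁ hk hψ
  refine ⟨MagneticKatok.katokMetric hs hα₀ hα₁ hk, MagneticKatok.etaDiffeo s k hα₀ hα₁, φ, ψ,
    MagneticKatok.dualInner_katokForm hs hα₀ hα₁ hk, fun z => ?_, hφ, hψ, hc⟩
  rw [MagneticKatok.etaForm_eq, sub_eq_add_neg, ← MagneticKatok.flat_neg]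
  rfl
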